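/- Consider a queue with Poisson arrivals of rate $\lambda>0$ and $K$ groups of servers. Group $k$ has $M_k$ servers with exponential service times of rate $\mu_k>0$, each costing $c_k\ge 0$ per unit of time while it is working. A holding cost $h(n)$ per unit of time is paid when $n$ customers are present, where $h$ is increasing and convex and $h(n)\to\infty$. An efficient policy $d$ prescribes, whenever $n$ customers are present, the number $d(n,k)\in\{0,\dots,M_k\}$ of working servers of each group $k$, with $\sum_k d(n,k)\le n$; the number of customers $n_t$ is then a birth-death process with birth rate $\lambda$ and death rate $\sum_k d(n,k)\mu_k$ in state $n$. The long-run average cost of $d$ is $$\eta^d=\lim_{T\to\infty}\mathbb E\Big\{\frac1T\int_0^T\Big[h(n_t)+\sum_{k=1}^K d(n_t,k)\,c_k\Big]dt\Big\},$$ and an optimal policy is an efficient policy whose long-run average cost is finite (and the same from every initial state) and minimal among all efficient policies. Assume scale economies: the groups are numbered so that $\frac{c_1}{\mu_1}\le\frac{c_2}{\mu_2}\le\cdots\le\frac{c_K}{\mu_K}$ and $\mu_1\ge\mu_2\ge\cdots\ge\mu_K$. Let $d^*$ be an optimal policy which resolves ties between groups with equal ratios by their numbering, that is, if $k<l$, $c_k/\mu_k=c_l/\mu_l$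 and $d^*(n,l)>0$, then $d^*(n,k)=M_k$. (If the ratios $c_k/\mu_k$ are pairwise different, this is no restriction.) Then $d^*(n,k)$ is nondecreasing in $n$ for every $k=1,\dots,K$; hence $d^*(n)=(d^*(n,1),\dots,d^*(n,K))$ is nondecreasing in $n$ in the componentwise order. Moreover, if there is an optimal policy, then there is one that resolves ties in this way. -/

import Mathlib

/-- The data of a group-server queue with `K` groups of servers (indexed by `Fin K`):
Poisson arrivals of rate `arrival`; group `k` has `servers k` exponential servers, each with
service rate `rate k` and operating cost `opCost k` per unit of time while it is working;
`hold n` is the holding cost per unit of time when `n` customers are present. -/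
structure GroupServerQueue (K : ℕ) where
  arrival : ℝ
  servers : Fin K → ℕ
  rate : Fin K → ℝ
  opCost : Fin K → ℝ
  hold : ℕ → ℝ
  arrival_pos : 0 < arrival
  rate_pos : ∀ k, 0 < rate k
  opCost_nonneg : ∀ k, 0 ≤ opCost k

namespace GroupServerQueue

variable {K : ℕ} (Q : GroupServerQueue K)

/-- The holding cost is increasing, convex and tends to infinity. -/
structure HoldingCostAssumption : Prop where
  increasing : Monotone Q.hold
  convex : ∀ n, Q.hold (n + 1) - Q.hold n ≤ Q.hold (n + 2) - Q.hold (n + 1)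
  tendsto : Filter.Tendsto Q.hold Filter.atTop Filter.atTop

/-- Scale economies: the groups are numbered in ascending order of the ratio `c / μ`, and in
this order the service rates are descending. -/
structure ScaleEconomies : Prop where
  ratio_ascending : ∀ k l, k ≤ l → Q.opCost k / Q.rate k ≤ Q.opCost l / Q.rate l
  rate_descending : ∀ k l, k ≤ l → Q.rate l ≤ Q.rate k

/-- An efficient stationary policy: `d n k` is the number of working servers of group `k` when
`n` customers are present; it is at most the size of the group, and the total number of working
servers is at most `n`. -/
def IsEfficient (d : ℕ → Fin K → ℕ) : Prop :=
  ∀ n, (∀ k, d n k ≤ Q.servers k) ∧ ∑ k, d n k ≤ n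

/-- The total service rate of the action `m`. -/
def serviceRate (m : Fin K → ℕ) : ℝ := ∑ k, (m k : ℝ) * Q.rate k

/-- The total cost rate in state `n` under the action `m`. -/
def costRate (n : ℕ) (m : Fin K → ℕ) : ℝ := Q.hold n + ∑ k, (m k : ℝ) * Q.opCost k

/-- Component `n` of the row vector `q B`, where `B` is the infinitesimal generator of the
number of customers under the policy `d`: a birth-death chain with birth rates `arrival` and
death rate `serviceRate (d n)` in state `n`. -/
def forward (d : ℕ → Fin K → ℕ) (q : ℕ → ℝ) : ℕ → ℝ
  | 0 => -Q.arrival * q 0 + Q.serviceRate (d 1) * q 1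
  | n + 1 => Q.arrival * q n - (Q.arrival + Q.serviceRate (d (n + 1))) * q (n + 1)
      + Q.serviceRate (d (n + 2)) * q (n + 2)

/-- `p t n` is the probability that `n` customers are present at time `t ≥ 0`, under the policy
`d` and with `i` customers at time `0`: the probability vectors `p t` solve the Kolmogorov
forward equation `p' = p B`. (All rates are bounded, so this determines `p t` for `t ≥ 0`.) -/
structure IsLaw (d : ℕ → Fin K → ℕ) (i : ℕ) (p : ℝ → ℕ → ℝ) : Prop where
  nonneg : ∀ t, 0 ≤ t → ∀ n, 0 ≤ p t n
  hasSum_one : ∀ t, 0 ≤ t → HasSum (p t) 1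
  initial : ∀ n, p 0 n = if n = i then 1 else 0
  kolmogorov : ∀ t, 0 ≤ t → ∀ n,
    HasDerivWithinAt (fun s => p s n) (Q.forward d (p t) n) (Set.Ici 0) t

/-- The long-run average cost of the policy `d` exists and is the real number `η`: from every
initial state, the expected cost up to time `T`, divided by `T`, is finite and tends to `η`. -/
def HasAverageCost (d : ℕ → Fin K → ℕ) (η : ℝ) : Prop :=
  ∀ i, ∃ p, Q.IsLaw d i p ∧
    (∀ t, 0 ≤ t → Summable fun n => p t n * Q.costRate n (d n)) ∧
    (∀ T, 0 ≤ T → IntervalIntegrable (fun t => ∑' n, p t n * Q.costRate n (d n))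
      MeasureTheory.volume 0 T) ∧
    Filter.Tendsto (fun T : ℝ => T⁻¹ * ∫ t in (0 : ℝ)..T, ∑' n, p t n * Q.costRate n (d n))
      Filter.atTop (nhds η)

/-- `d` is an optimal policy: it minimizes the (finite) long-run average cost over all efficient
policies. -/
def IsOptimal (d : ℕ → Fin K → ℕ) : Prop :=
  Q.IsEfficient d ∧ ∃ η, Q.HasAverageCost d η ∧
    ∀ d' η', Q.IsEfficient d' → Q.HasAverageCost d' η' → η ≤ η'

/-- Ties between groups with *equal* ratio `c / μ` are resolved by the numbering of the groups.
(This says nothing about groups with different ratios, and it holds for every policy if the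
ratios are pairwise different.) -/
def BreaksRatioTies (d : ℕ → Fin K → ℕ) : Prop :=
  ∀ n k l, k < l → Q.opCost k / Q.rate k = Q.opCost l / Q.rate l →
    0 < d n l → d n k = Q.servers k

end GroupServerQueue

/-!
For an efficient policy with stationary distribution `w` and stationary mean cost `η`, the Poisson
equation determines the differences `G n` of the performance potentials, and summing it against the
stationary distribution of another policy expresses the difference of the mean costs through the
gains `∑ k, m k * (μ k * G n - c k)` of the actions `m`. Hence the action of an optimal policy in a
recurrent state maximizes the gain. The largest gain in state `n` satisfies an exchange inequality
in `n` and `G n`, and together with the convexity of `h` it shows that once `G` fails to increase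
strictly, it is nonincreasing from there on; then `h n → ∞` makes `G` negative, which no stationary
policy of finite cost allows. So all states are recurrent and `G` is strictly increasing.

If an optimal action in state `n` used more servers of group `k` than the one in state `n + 1`, then
the latter would use more servers of some group `l` than the former. By optimality of both actions
and scale economies this is possible only if the ratios of `k` and `l` agree, where the tie-breaking
rule forbids it. Breaking ties changes the service rate only where `G n` equals some ratio
`c k / μ k`, that is, in finitely many states, so it does not affect the mean cost.

That long-run average costs are stationary mean costs rests on tightness of time averages, because
`h n → ∞`, in one direction, and in the other one on a domination of all transition probabilities by
a multiple of `w`, obtained from the uniformized jump chain.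
-/

/-! ### Limits of probability vectors -/

section LimitsOfProbabilityVectors

open Filter Topology

variable {ι α : Type*} {l : Filter ι} [l.NeBot] {π : ι → α → ℝ} {w f : α → ℝ} {m : ι → ℝ} {η : ℝ}

lemma sum_mul_sub_le_of_tendsto (hπ0 : ∀ᶠ i in l, ∀ a, 0 ≤ π i a)
    (hπ1 : ∀ᶠ i in l, HasSum (π i) 1) (hπ : ∀ a, Tendsto (π · a) l (𝓝 (w a)))
    (hm : ∀ᶠ i in l, HasSum (fun a => π i a * f a) (m i)) (hη : Tendsto m l (𝓝 η))
    {s : Finset α} {M : ℝ} (hM : ∀ a ∉ s, M ≤ f a) :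
    ∑ a ∈ s, w a * (f a - M) ≤ η - M := by
  refine le_of_tendsto_of_tendsto (tendsto_finsetSum _ fun a _ => (hπ a).mul_const _)
    (hη.sub_const M) ?_
  filter_upwards [hπ0, hπ1, hm] with i h0 h1 hi
  have hsum : HasSum (fun a => π i a * (f a - M)) (m i - M) := by
    simpa only [mul_sub, one_mul] using hi.sub (h1.mul_right M)
  exact sum_le_hasSum s (fun a ha => mul_nonneg (h0 a) (sub_nonneg.2 (hM a ha))) hsum

lemma summable_of_tendsto_of_hasSum_one (hπ0 : ∀ᶠ i in l, ∀ a, 0 ≤ π i a)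
    (hπ1 : ∀ᶠ i in l, HasSum (π i) 1) (hπ : ∀ a, Tendsto (π · a) l (𝓝 (w a))) :
    Summable w ∧ ∑' a, w a ≤ 1 := by
  have hw0 : ∀ a, 0 ≤ w a := fun a => ge_of_tendsto (hπ a) (hπ0.mono fun i h => h a)
  have hsum : ∀ s : Finset α, ∑ a ∈ s, w a ≤ 1 := fun s =>
    le_of_tendsto (tendsto_finsetSum s fun a _ => hπ a) <| by
      filter_upwards [hπ0, hπ1] with i h0 h1 using sum_le_hasSum s (fun a _ => h0 a) h1
  have hw : Summable w := summable_of_sum_le hw0 hsum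
  exact ⟨hw, hw.tsum_le_of_sum_le hsum⟩

lemma exists_forall_le_of_tendsto_cofinite (hf : Tendsto f cofinite atTop) :
    ∃ c, ∀ a, c ≤ f a := by
  rcases isEmpty_or_nonempty α with h | h
  · exact ⟨0, fun a => h.elim a⟩
  · obtain ⟨a₀, ha₀⟩ := hf.exists_forall_le
    exact ⟨f a₀, ha₀⟩

/- Tightness: mass `1 - ∑ w` escaping to the region where `f ≥ M` would cost at least
`M * (1 - ∑ w)`, for every `M`. -/
lemma hasSum_one_of_tendsto (hπ0 : ∀ᶠ i in l, ∀ a, 0 ≤ π i a)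
    (hπ1 : ∀ᶠ i in l, HasSum (π i) 1) (hπ : ∀ a, Tendsto (π · a) l (𝓝 (w a)))
    (hf : Tendsto f cofinite atTop) (hm : ∀ᶠ i in l, HasSum (fun a => π i a * f a) (m i))
    (hη : Tendsto m l (𝓝 η)) : HasSum w 1 := by
  have hw0 : ∀ a, 0 ≤ w a := fun a => ge_of_tendsto (hπ a) (hπ0.mono fun i h => h a)
  obtain ⟨hw, hw1⟩ := summable_of_tendsto_of_hasSum_one hπ0 hπ1 hπ
  obtain ⟨c, hc⟩ := exists_forall_le_of_tendsto_cofinite hf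
  have hescape : ∀ M, c ≤ M → (M - c) * (1 - ∑' a, w a) ≤ η - c := fun M hcM => by
    have hfin : {a | ¬ M ≤ f a}.Finite := hf.eventually_ge_atTop M
    have hmean := sum_mul_sub_le_of_tendsto hπ0 hπ1 hπ hm hη (s := hfin.toFinset) (M := M)
      fun a ha => by simpa using ha
    have hlow : ∑ a ∈ hfin.toFinset, w a * (c - M) ≤ ∑ a ∈ hfin.toFinset, w a * (f a - M) :=
      Finset.sum_le_sum fun a _ => mul_le_mul_of_nonneg_left (sub_le_sub_right (hc a) M) (hw0 a)
    have htotal : ∑ a ∈ hfin.toFinset, w a ≤ ∑' a, w a := hw.sum_le_tsum _ fun a _ => hw0 a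
    rw [← Finset.sum_mul] at hlow
    nlinarith
  suffices 1 ≤ ∑' a, w a from le_antisymm hw1 this ▸ hw.hasSum
  by_contra! hlt
  have hpos : 0 < 1 - ∑' a, w a := sub_pos.2 hlt
  have hbound := hescape (c + (|η - c| + 1) / (1 - ∑' a, w a))
    (le_add_of_nonneg_right (by positivity))
  rw [add_sub_cancel_left, div_mul_cancel₀ _ hpos.ne'] at hbound
  linarith [le_abs_self (η - c)]

lemma exists_hasSum_mul_le_of_tendsto (hπ0 : ∀ᶠ i in l, ∀ a, 0 ≤ π i a)
    (hπ1 : ∀ᶠ i in l, HasSum (π i) 1) (hπ : ∀ a, Tendsto (π · a) l (𝓝 (w a)))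
    (hf : Tendsto f cofinite atTop) (hm : ∀ᶠ i in l, HasSum (fun a => π i a * f a) (m i))
    (hη : Tendsto m l (𝓝 η)) : ∃ η' ≤ η, HasSum (fun a => w a * f a) η' := by
  have hw0 : ∀ a, 0 ≤ w a := fun a => ge_of_tendsto (hπ a) (hπ0.mono fun i h => h a)
  have hw1 : HasSum w 1 := hasSum_one_of_tendsto hπ0 hπ1 hπ hf hm hη
  obtain ⟨c, hc⟩ := exists_forall_le_of_tendsto_cofinite hf
  have hsum : ∀ s : Finset α, ∑ a ∈ s, w a * (f a - c) ≤ η - c := fun s =>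
    sum_mul_sub_le_of_tendsto hπ0 hπ1 hπ hm hη fun a _ => hc a
  have hs : Summable fun a => w a * (f a - c) :=
    summable_of_sum_le (fun a => mul_nonneg (hw0 a) (sub_nonneg.2 (hc a))) hsum
  refine ⟨∑' a, w a * (f a - c) + c, le_sub_iff_add_le.1 (hs.tsum_le_of_sum_le hsum), ?_⟩
  simpa only [← mul_add, sub_add_cancel, one_mul] using hs.hasSum.add (hw1.mul_right c)

end LimitsOfProbabilityVectors

/-! ### Poisson means and uniformization -/

/-- The expectation of `a N` for a Poisson random variable `N` of mean `s`, used to write the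
law of a uniformized chain. The mean is a real number, not a nonnegative one, so that the
expectation can be differentiated at `0`. -/
noncomputable def poissonMean (a : ℕ → ℝ) (s : ℝ) : ℝ :=
  Real.exp (-s) * ∑' k, a k * (s ^ k / (k.factorial : ℝ))

section PoissonMean

variable {a b : ℕ → ℝ} {C : ℝ}

lemma norm_mul_pow_div_factorial_le {R s : ℝ} (ha : ∀ k, |a k| ≤ C) (hs : |s| ≤ R) (k : ℕ) :
    ‖a k * (s ^ k / (k.factorial : ℝ))‖ ≤ C * (R ^ k / (k.factorial : ℝ)) := by
  have hC : 0 ≤ C := (abs_nonneg _).trans (ha 0)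
  rw [norm_mul, norm_div, norm_pow, Real.norm_natCast, Real.norm_eq_abs, Real.norm_eq_abs]
  gcongr
  exact ha k

lemma summable_mul_pow_div_factorial (ha : ∀ k, |a k| ≤ C) (s : ℝ) :
    Summable fun k => a k * (s ^ k / (k.factorial : ℝ)) :=
  .of_norm_bounded ((Real.summable_pow_div_factorial |s|).mul_left C)
    (norm_mul_pow_div_factorial_le ha le_rfl)

lemma hasDerivAt_pow_succ_div_factorial (k : ℕ) (s : ℝ) :
    HasDerivAt (fun s : ℝ => s ^ (k + 1) / ((k + 1).factorial : ℝ)) (s ^ k / (k.factorial : ℝ))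
      s := by
  refine ((hasDerivAt_pow (k + 1) s).div_const _).congr_deriv ?_
  rw [Nat.factorial_succ, Nat.add_sub_cancel, Nat.cast_mul]
  exact mul_div_mul_left _ _ (Nat.cast_ne_zero.2 k.succ_ne_zero)

lemma hasDerivAt_tsum_mul_pow_div_factorial (ha : ∀ k, |a k| ≤ C) (s : ℝ) :
    HasDerivAt (fun s => ∑' k, a k * (s ^ k / (k.factorial : ℝ)))
      (∑' k, a (k + 1) * (s ^ k / (k.factorial : ℝ))) s := by
  have hsucc : ∀ k, |a (k + 1)| ≤ C := fun k => ha (k + 1)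
  have htail : HasDerivAt (fun s => ∑' k, a (k + 1) * (s ^ (k + 1) / ((k + 1).factorial : ℝ)))
      (∑' k, a (k + 1) * (s ^ k / (k.factorial : ℝ))) s := by
    have hs : s ∈ Metric.ball (0 : ℝ) (|s| + 1) := by simp
    refine hasDerivAt_tsum_of_isPreconnected
      ((Real.summable_pow_div_factorial (|s| + 1)).mul_left C) Metric.isOpen_ball
      (convex_ball _ _).isPreconnected
      (fun k y _ => (hasDerivAt_pow_succ_div_factorial k y).const_mul (a (k + 1)))
      (fun k y hy => norm_mul_pow_div_factorial_le hsucc ?_ k) hs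
      ((summable_nat_add_iff 1).2 (summable_mul_pow_div_factorial ha s)) hs
    simpa using (Metric.mem_ball.1 hy).le
  refine (htail.const_add (a 0)).congr_of_eventuallyEq (.of_forall fun y => ?_)
  simpa using (summable_mul_pow_div_factorial ha y).tsum_eq_zero_add

lemma poissonMean_sub (ha : ∀ k, |a k| ≤ C) (hb : ∀ k, |b k| ≤ C) (s : ℝ) :
    poissonMean (fun k => a k - b k) s = poissonMean a s - poissonMean b s := by
  simp only [poissonMean, sub_mul, ← mul_sub, (summable_mul_pow_div_factorial ha s).tsum_sub
    (summable_mul_pow_div_factorial hb s)]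

lemma poissonMean_const_mul (x s : ℝ) :
    poissonMean (fun k => x * a k) s = x * poissonMean a s := by
  simp only [poissonMean, mul_assoc, tsum_mul_left, mul_left_comm]

lemma hasDerivAt_poissonMean (ha : ∀ k, |a k| ≤ C) (s : ℝ) :
    HasDerivAt (poissonMean a) (poissonMean (fun k => a (k + 1) - a k) s) s := by
  rw [poissonMean_sub (fun k => ha (k + 1)) ha]
  refine ((hasDerivAt_neg s).exp.mul (hasDerivAt_tsum_mul_pow_div_factorial ha s)).congr_deriv ?_
  unfold poissonMean
  ring

lemma hasSum_poisson (s : ℝ) : HasSum (fun k : ℕ => s ^ k / (k.factorial : ℝ)) (Real.exp s) := by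
  rw [Real.exp_eq_exp_ℝ]
  exact NormedSpace.expSeries_div_hasSum_exp s

lemma poissonMean_const (x s : ℝ) : poissonMean (fun _ => x) s = x := by
  rw [poissonMean, tsum_mul_left, (hasSum_poisson s).tsum_eq, mul_left_comm, ← Real.exp_add,
    neg_add_cancel, Real.exp_zero, mul_one]

lemma poissonMean_nonneg (ha : ∀ k, 0 ≤ a k) {s : ℝ} (hs : 0 ≤ s) : 0 ≤ poissonMean a s :=
  mul_nonneg (Real.exp_pos _).le (tsum_nonneg fun k => mul_nonneg (ha k) (by positivity))

lemma poissonMean_le (ha : ∀ k, |a k| ≤ C) {s : ℝ} (hs : 0 ≤ s) : poissonMean a s ≤ C := by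
  have hC : ∀ _ : ℕ, |C| ≤ C := fun _ => (abs_of_nonneg ((abs_nonneg _).trans (ha 0))).le
  rw [← sub_nonneg]
  nth_rewrite 1 [← poissonMean_const C s]
  rw [← poissonMean_sub hC ha]
  exact poissonMean_nonneg (fun k => sub_nonneg.2 ((le_abs_self _).trans (ha k))) hs

lemma poissonMean_zero : poissonMean a 0 = a 0 := by
  rw [poissonMean, tsum_eq_single 0 fun k hk => by simp [hk]]
  simp

lemma hasSum_poissonMean {α : Type*} {v : ℕ → α → ℝ} (hv0 : ∀ k x, 0 ≤ v k x)
    (hv : ∀ k, HasSum (v k) 1) {s : ℝ} (hs : 0 ≤ s) :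
    HasSum (fun x => poissonMean (fun k => v k x) s) 1 := by
  have hrow : ∀ k, HasSum (fun x => v k x * (s ^ k / (k.factorial : ℝ)))
      (s ^ k / (k.factorial : ℝ)) := fun k => by simpa using (hv k).mul_right _
  have hS : Summable (Function.uncurry fun k x => v k x * (s ^ k / (k.factorial : ℝ))) :=
    (summable_prod_of_nonneg fun x => mul_nonneg (hv0 x.1 x.2) (by positivity)).2
      ⟨fun k => (hrow k).summable,
        (Real.summable_pow_div_factorial s).congr fun k => (hrow k).tsum_eq.symm⟩
  have htotal : ∑' x, ∑' k, v k x * (s ^ k / (k.factorial : ℝ)) = Real.exp s := by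
    rw [hS.tsum_comm, ← (hasSum_poisson s).tsum_eq]
    exact tsum_congr fun k => (hrow k).tsum_eq
  have hmass : HasSum (fun x => ∑' k, v k x * (s ^ k / (k.factorial : ℝ))) (Real.exp s) :=
    htotal ▸ hS.prod_symm.prod.hasSum
  simpa only [poissonMean, ← Real.exp_add, neg_add_cancel, Real.exp_zero]
    using hmass.mul_left (Real.exp (-s))

end PoissonMean

namespace GroupServerQueue

open Filter Topology

variable {K : ℕ} {Q : GroupServerQueue K} {d : ℕ → Fin K → ℕ} {v : ℕ → ℝ}

lemma serviceRate_nonneg (m : Fin K → ℕ) : 0 ≤ Q.serviceRate m :=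
  Finset.sum_nonneg fun k _ => mul_nonneg (Nat.cast_nonneg _) (Q.rate_pos k).le

lemma serviceRate_mono : Monotone Q.serviceRate := fun _ _ h =>
  Finset.sum_le_sum fun k _ => mul_le_mul_of_nonneg_right (Nat.cast_le.2 (h k)) (Q.rate_pos k).le

lemma serviceRate_eq_zero_iff {m : Fin K → ℕ} : Q.serviceRate m = 0 ↔ m = 0 := by
  rw [serviceRate, Finset.sum_eq_zero_iff_of_nonneg
    fun k _ => mul_nonneg (Nat.cast_nonneg _) (Q.rate_pos k).le]
  simp [(Q.rate_pos _).ne', funext_iff]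

lemma IsEfficient.serviceRate_le (hd : Q.IsEfficient d) (n : ℕ) :
    Q.serviceRate (d n) ≤ Q.serviceRate Q.servers :=
  serviceRate_mono (hd n).1

lemma IsEfficient.serviceRate_zero (hd : Q.IsEfficient d) : Q.serviceRate (d 0) = 0 :=
  serviceRate_eq_zero_iff.2 (by simpa [funext_iff] using (hd 0).2)

lemma sum_forward (v : ℕ → ℝ) (N : ℕ) :
    ∑ n ∈ Finset.range (N + 1), Q.forward d v n
      = Q.serviceRate (d (N + 1)) * v (N + 1) - Q.arrival * v N := by
  induction N with
  | zero => simp [forward]; ring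
  | succ N ih => rw [Finset.sum_range_succ, ih, forward]; ring

lemma IsEfficient.summable_serviceRate_mul (hd : Q.IsEfficient d) (hv : Summable v) :
    Summable fun n => Q.serviceRate (d n) * v n :=
  .of_norm_bounded (hv.norm.mul_left (Q.serviceRate Q.servers)) fun n => by
    rw [norm_mul, Real.norm_of_nonneg (serviceRate_nonneg _)]
    exact mul_le_mul_of_nonneg_right (hd.serviceRate_le n) (norm_nonneg _)

lemma IsEfficient.hasSum_forward (hd : Q.IsEfficient d) (hv : Summable v) :
    HasSum (Q.forward d v) 0 := by
  have hμ := hd.summable_serviceRate_mul hv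
  have hsum : Summable (Q.forward d v) := by
    have harr := hv.mul_left Q.arrival
    rw [← summable_nat_add_iff 1]
    refine ((harr.sub ((summable_nat_add_iff 1).2 (harr.add hμ))).add
      ((summable_nat_add_iff 2).2 hμ)).congr fun n => ?_
    simp only [forward]
    ring
  have hlim : Tendsto (fun N => ∑ n ∈ Finset.range (N + 1), Q.forward d v n) atTop (𝓝 0) := by
    simp_rw [sum_forward]
    simpa using ((summable_nat_add_iff 1).2 hμ).tendsto_atTop_zero.sub
      (hv.mul_left Q.arrival).tendsto_atTop_zero
  rw [← tendsto_nhds_unique ((tendsto_add_atTop_iff_nat 1).2 hsum.hasSum.tendsto_sum_nat) hlim]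
  exact hsum.hasSum

variable (Q d) in
/-- The generator `q ↦ q B` as a continuous linear map, for the topology of pointwise convergence
of row vectors: it therefore commutes with pointwise limits, sums and integrals. -/
def forwardCLM : (ℕ → ℝ) →L[ℝ] (ℕ → ℝ) where
  toFun := Q.forward d
  map_add' u v := by
    funext n
    cases n <;> simp only [forward, Pi.add_apply] <;> ring
  map_smul' c v := by
    funext n
    cases n <;> simp only [forward, Pi.smul_apply, smul_eq_mul, RingHom.id_apply] <;> ring
  cont := continuous_pi fun n => by cases n <;> simp only [forward] <;> fun_prop

@[simp] lemma forwardCLM_apply (v : ℕ → ℝ) : Q.forwardCLM d v = Q.forward d v := rfl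

/-- The uniformization constant, an upper bound for the total transition rate of any state. -/
def uniformRate (Q : GroupServerQueue K) : ℝ := Q.arrival + Q.serviceRate Q.servers

lemma uniformRate_pos : 0 < Q.uniformRate :=
  add_pos_of_pos_of_nonneg Q.arrival_pos (serviceRate_nonneg _)

variable (Q d) in
/-- One step of the uniformized chain, the discrete-time chain that is watched at the times of a
Poisson process of rate `uniformRate`, acting on row vectors. -/
noncomputable def uniformStep : (ℕ → ℝ) →L[ℝ] (ℕ → ℝ) :=
  .id ℝ _ + Q.uniformRate⁻¹ • Q.forwardCLM d

lemma uniformStep_apply (v : ℕ → ℝ) (n : ℕ) :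
    Q.uniformStep d v n = v n + Q.uniformRate⁻¹ * Q.forward d v n := rfl

lemma uniformStep_nonneg (hd : Q.IsEfficient d) (hv : 0 ≤ v) : 0 ≤ Q.uniformStep d v := by
  intro n
  suffices 0 ≤ Q.uniformRate * v n + Q.forward d v n by
    have hstep : Q.uniformStep d v n
        = Q.uniformRate⁻¹ * (Q.uniformRate * v n + Q.forward d v n) := by
      rw [uniformStep_apply, mul_add, inv_mul_cancel_left₀ uniformRate_pos.ne']
    exact hstep ▸ mul_nonneg (inv_nonneg.2 uniformRate_pos.le) this
  have hout := mul_le_mul_of_nonneg_right (hd.serviceRate_le n) (hv n)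
  have hin := mul_nonneg (serviceRate_nonneg (Q := Q) (d (n + 1))) (hv (n + 1))
  cases n with
  | zero =>
    have hzero := mul_nonneg (serviceRate_nonneg (Q := Q) (d 0)) (hv 0)
    simp only [forward, uniformRate, zero_add] at *
    linarith
  | succ n =>
    have harr := mul_nonneg Q.arrival_pos.le (hv n)
    simp only [forward, uniformRate] at *
    linarith

lemma uniformStep_mono (hd : Q.IsEfficient d) : Monotone (Q.uniformStep d) := fun u v h => by
  rw [← sub_nonneg, ← map_sub]
  exact uniformStep_nonneg hd (sub_nonneg.2 h)

lemma hasSum_uniformStep (hd : Q.IsEfficient d) {x : ℝ} (hv : HasSum v x) :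
    HasSum (Q.uniformStep d v) x := by
  have hstep := hv.add ((hd.hasSum_forward hv.summable).mul_left Q.uniformRate⁻¹)
  rwa [mul_zero, add_zero] at hstep

variable (Q d) in
/-- The distribution of the uniformized chain after `k` steps, started in state `i`. -/
noncomputable def uniformChain (i k : ℕ) : ℕ → ℝ := (Q.uniformStep d)^[k] (Pi.single i 1)

lemma uniformChain_zero (i n : ℕ) : Q.uniformChain d i 0 n = if n = i then 1 else 0 :=
  Pi.single_apply i 1 n

lemma uniformChain_succ (i k : ℕ) :
    Q.uniformChain d i (k + 1) = Q.uniformStep d (Q.uniformChain d i k) :=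
  Function.iterate_succ_apply' _ _ _

lemma uniformChain_nonneg (hd : Q.IsEfficient d) (i k : ℕ) : 0 ≤ Q.uniformChain d i k := by
  induction k with
  | zero => exact Pi.single_nonneg.2 zero_le_one
  | succ k ih => exact uniformChain_succ (Q := Q) i k ▸ uniformStep_nonneg hd ih

lemma hasSum_uniformChain (hd : Q.IsEfficient d) (i k : ℕ) : HasSum (Q.uniformChain d i k) 1 := by
  induction k with
  | zero => exact hasSum_pi_single i 1
  | succ k ih => exact uniformChain_succ (Q := Q) i k ▸ hasSum_uniformStep hd ih

lemma abs_uniformChain_le_one (hd : Q.IsEfficient d) (i k n : ℕ) :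
    |Q.uniformChain d i k n| ≤ 1 := by
  rw [abs_of_nonneg (uniformChain_nonneg hd i k n)]
  exact le_hasSum (hasSum_uniformChain hd i k) n fun m _ => uniformChain_nonneg hd i k m

variable (Q d) in
/-- The transition probabilities of the number of customers, by uniformization: the number of
steps of the uniformized chain up to time `t` is a Poisson variable of mean `uniformRate * t`. -/
noncomputable def transition (i : ℕ) (t : ℝ) (n : ℕ) : ℝ :=
  poissonMean (fun k => Q.uniformChain d i k n) (Q.uniformRate * t)

lemma poissonMean_forward {u : ℕ → ℕ → ℝ} {C : ℝ} (hu : ∀ k n, |u k n| ≤ C) (s : ℝ) (n : ℕ) :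
    poissonMean (fun k => Q.forward d (u k) n) s
      = Q.forward d (fun n => poissonMean (fun k => u k n) s) n := by
  have hsum : HasSum (fun k => (s ^ k / (k.factorial : ℝ)) • u k)
      (fun n => ∑' k, u k n * (s ^ k / (k.factorial : ℝ))) :=
    Pi.hasSum.2 fun n => by
      simpa only [Pi.smul_apply, smul_eq_mul, mul_comm]
        using (summable_mul_pow_div_factorial (fun k => hu k n) s).hasSum
  have hforward := Pi.hasSum.1 ((Q.forwardCLM d).hasSum hsum) n
  simp only [map_smul, forwardCLM_apply, Pi.smul_apply, smul_eq_mul] at hforward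
  simp only [poissonMean, mul_comm (Q.forward d (u _) n), hforward.tsum_eq]
  exact (congrFun ((Q.forwardCLM d).map_smul (Real.exp (-s))
    fun n => ∑' k, u k n * (s ^ k / (k.factorial : ℝ))) n).symm

lemma isLaw_transition (hd : Q.IsEfficient d) (i : ℕ) : Q.IsLaw d i (Q.transition d i) where
  nonneg t ht n := poissonMean_nonneg (fun k => uniformChain_nonneg hd i k n)
    (mul_nonneg uniformRate_pos.le ht)
  hasSum_one t ht := hasSum_poissonMean (uniformChain_nonneg hd i) (hasSum_uniformChain hd i)
    (mul_nonneg uniformRate_pos.le ht)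
  initial n := by simp [transition, poissonMean_zero, uniformChain_zero]
  kolmogorov t _ n := by
    have hstep : ∀ k, Q.uniformChain d i (k + 1) n - Q.uniformChain d i k n
        = Q.uniformRate⁻¹ * Q.forward d (Q.uniformChain d i k) n := fun k => by
      rw [uniformChain_succ, uniformStep_apply, add_sub_cancel_left]
    have hderiv := (hasDerivAt_poissonMean (fun k => abs_uniformChain_le_one hd i k n)
      (Q.uniformRate * t)).comp t ((hasDerivAt_id t).const_mul Q.uniformRate)
    simp only [hstep, poissonMean_const_mul, poissonMean_forward (abs_uniformChain_le_one hd i),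
      mul_one] at hderiv
    rw [mul_comm, mul_inv_cancel_left₀ uniformRate_pos.ne'] at hderiv
    exact hderiv.hasDerivWithinAt

end GroupServerQueue

/-! ### Stationary distributions -/

namespace GroupServerQueue

open Filter Topology

variable {K : ℕ} {Q : GroupServerQueue K} {d : ℕ → Fin K → ℕ} {v w x y : ℕ → ℝ}

variable (Q) in
/-- `w` is a stationary distribution of the number of customers under the policy `d`, in the form
of the detailed balance equations of a birth-death chain. -/
structure IsStationary (d : ℕ → Fin K → ℕ) (w : ℕ → ℝ) : Prop where
  nonneg : ∀ n, 0 ≤ w n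
  hasSum_one : HasSum w 1
  balance : ∀ n, Q.serviceRate (d (n + 1)) * w (n + 1) = Q.arrival * w n

lemma balance_iff_forward_eq_zero :
    (∀ n, Q.serviceRate (d (n + 1)) * w (n + 1) = Q.arrival * w n) ↔
      ∀ n, Q.forward d w n = 0 := by
  constructor
  · rintro h (_ | n)
    · simp only [forward]
      linarith [h 0]
    · simp only [forward]
      linarith [h n, h (n + 1)]
  · intro h n
    rw [← sub_eq_zero, ← sum_forward, Finset.sum_eq_zero fun j _ => h j]

namespace IsStationary

lemma arrival_pow_mul (hw : Q.IsStationary d w) (n k : ℕ) :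
    Q.arrival ^ k * w n = (∏ j ∈ Finset.range k, Q.serviceRate (d (n + j + 1))) * w (n + k) := by
  induction k with
  | zero => simp
  | succ k ih =>
    rw [pow_succ', mul_assoc, ih, mul_left_comm, ← hw.balance (n + k), Finset.prod_range_succ,
      mul_assoc, add_assoc n k 1]

lemma pos_of_le (hw : Q.IsStationary d w) {m n : ℕ} (hmn : m ≤ n) (hm : 0 < w m) : 0 < w n := by
  obtain ⟨k, rfl⟩ := Nat.exists_eq_add_of_le hmn
  have hpos := mul_pos (pow_pos Q.arrival_pos k) hm
  rw [hw.arrival_pow_mul] at hpos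
  exact pos_of_mul_pos_right hpos (Finset.prod_nonneg fun j _ => serviceRate_nonneg _)

lemma exists_pos (hw : Q.IsStationary d w) : ∃ n, 0 < w n := by
  by_contra! h
  have hzero : w = 0 := funext fun n => le_antisymm (h n) (hw.nonneg n)
  exact zero_ne_one (hasSum_zero.unique (hzero ▸ hw.hasSum_one))

lemma exists_first_pos (hw : Q.IsStationary d w) :
    ∃ b, (∀ n < b, w n = 0) ∧ ∀ n, b ≤ n → 0 < w n := by
  classical
  refine ⟨Nat.find hw.exists_pos, fun n hn => ?_, fun n hn =>
    hw.pos_of_le hn (Nat.find_spec hw.exists_pos)⟩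
  exact le_antisymm (not_lt.1 (Nat.find_min hw.exists_pos hn)) (hw.nonneg n)

lemma serviceRate_first_pos (hd : Q.IsEfficient d) (hw : Q.IsStationary d w) {b : ℕ}
    (hlt : ∀ n < b, w n = 0) (hpos : 0 < w b) : Q.serviceRate (d b) = 0 := by
  cases b with
  | zero => exact hd.serviceRate_zero
  | succ b =>
    have hbalance := hw.balance b
    rwa [hlt b b.lt_succ_self, mul_zero, mul_eq_zero, or_iff_left hpos.ne'] at hbalance

lemma mul_comm_of_isStationary (hx : Q.IsStationary d x) (hy : Q.IsStationary d y) (m n : ℕ) :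
    x m * y n = y m * x n := by
  wlog hmn : m ≤ n generalizing m n
  · rw [mul_comm, ← this n m (not_le.1 hmn).le, mul_comm]
  obtain ⟨k, rfl⟩ := Nat.exists_eq_add_of_le hmn
  apply mul_left_cancel₀ (pow_pos Q.arrival_pos k).ne'
  rw [← mul_assoc, hx.arrival_pow_mul, ← mul_assoc, hy.arrival_pow_mul]
  ring

lemma unique (hx : Q.IsStationary d x) (hy : Q.IsStationary d y) : x = y := by
  funext m
  have hsum := hy.hasSum_one.mul_left (x m)
  simp only [mul_comm_of_isStationary hx hy m, mul_one] at hsum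
  simpa using hsum.unique (hx.hasSum_one.mul_left (y m))

lemma uniformStep_eq (hw : Q.IsStationary d w) : Q.uniformStep d w = w := by
  funext n
  rw [uniformStep_apply, balance_iff_forward_eq_zero.1 hw.balance n, mul_zero, add_zero]

end IsStationary

section Domination

variable {b : ℕ}

lemma sum_sub_sum_uniformStep (v : ℕ → ℝ) (hb : Q.serviceRate (d (b + 1)) = 0) :
    ∑ j ∈ Finset.range (b + 1), v j - ∑ j ∈ Finset.range (b + 1), Q.uniformStep d v j
      = Q.uniformRate⁻¹ * (Q.arrival * v b) := by
  simp only [uniformStep_apply, Finset.sum_add_distrib, ← Finset.mul_sum, sum_forward, hb]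
  ring

lemma uniformStep_indicator_Iio (v : ℕ → ℝ) (hb : Q.serviceRate (d b) = 0) {n : ℕ} (hn : b ≤ n) :
    Q.uniformStep d ((Set.Iio b).indicator v) n
      = if n = b then ∑ j ∈ Finset.range b, v j - ∑ j ∈ Finset.range b, Q.uniformStep d v j
        else 0 := by
  have hout : ∀ m, b ≤ m → (Set.Iio b).indicator v m = 0 := fun m hm =>
    Set.indicator_of_notMem (s := Set.Iio b) (not_lt.2 hm) v
  rw [uniformStep_apply, hout n hn, zero_add]
  cases n with
  | zero =>
    obtain rfl : b = 0 := Nat.le_zero.1 hn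
    simp [forward]
  | succ n =>
    simp only [forward, hout (n + 1) hn, hout (n + 2) (by omega)]
    split_ifs with h
    · subst h
      rw [sum_sub_sum_uniformStep v hb, Set.indicator_of_mem (Set.mem_Iio.2 n.lt_succ_self)]
      ring
    · rw [hout n (by omega)]
      ring

lemma IsStationary.uniformStep_le (hd : Q.IsEfficient d) (hw : Q.IsStationary d w)
    (hlt : ∀ n < b, w n = 0) (hv : 0 ≤ v) {A C : ℝ} (hC : 1 ≤ C * w b)
    (hle : ∀ n, b ≤ n → v n ≤ A * w n) {n : ℕ} (hn : b ≤ n) :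
    Q.uniformStep d v n ≤ (A + C * (∑ j ∈ Finset.range b, v j
      - ∑ j ∈ Finset.range b, Q.uniformStep d v j)) * w n := by
  have hCpos : 0 < C * w b := one_pos.trans_le hC
  have hwb : 0 < w b := (hw.nonneg b).lt_of_ne fun h => by simp [← h] at hCpos
  have hidle := hw.serviceRate_first_pos hd hlt hwb
  set u := (Set.Iio b).indicator v
  set Δ := ∑ j ∈ Finset.range b, v j - ∑ j ∈ Finset.range b, Q.uniformStep d v j
  have hu : 0 ≤ u := Set.indicator_nonneg fun m _ => hv m
  have hvu : v ≤ A • w + u := fun m => by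
    rcases lt_or_ge m b with hm | hm
    · simp [u, hlt m hm, hm]
    · simpa [u, hm.not_gt] using hle m hm
  have hstep : Q.uniformStep d v n ≤ A * w n + Q.uniformStep d u n := by
    have hmono := uniformStep_mono hd hvu n
    rwa [map_add, map_smul, hw.uniformStep_eq] at hmono
  have hΔ : 0 ≤ Δ := by
    have hnonneg := uniformStep_nonneg hd hu b
    rwa [uniformStep_indicator_Iio v hidle le_rfl, if_pos rfl] at hnonneg
  refine hstep.trans ?_
  rw [add_mul, uniformStep_indicator_Iio v hidle hn]
  gcongr
  split_ifs with h
  · rw [h, mul_right_comm]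
    exact le_mul_of_one_le_left hΔ hC
  · exact mul_nonneg (mul_nonneg (pos_of_mul_pos_left hCpos hwb.le).le hΔ) (hw.nonneg n)

/- `1 - ∑ j < b, P j` is the mass that has reached the positive recurrent states `b, b + 1, …`;
each unit of it enters at `b` or starts at `i`, hence below `C` times `w`, and `w` is invariant. -/
lemma IsStationary.uniformChain_le (hd : Q.IsEfficient d) (hw : Q.IsStationary d w)
    (hlt : ∀ n < b, w n = 0) {i : ℕ} {C : ℝ} (hCb : 1 ≤ C * w b)
    (hCi : b ≤ i → 1 ≤ C * w i) (hC0 : 0 ≤ C) (k : ℕ) {n : ℕ} (hn : b ≤ n) :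
    Q.uniformChain d i k n
      ≤ C * (1 - ∑ j ∈ Finset.range b, Q.uniformChain d i k j) * w n := by
  induction k generalizing n with
  | zero =>
    have hmass : ∑ j ∈ Finset.range b, Q.uniformChain d i 0 j ≤ 1 :=
      sum_le_hasSum _ (fun j _ => uniformChain_nonneg hd i 0 j) (hasSum_uniformChain hd i 0)
    rcases eq_or_ne n i with rfl | hni
    · have hzero : ∑ j ∈ Finset.range b, Q.uniformChain d n 0 j = 0 :=
        Finset.sum_eq_zero fun j hj => (uniformChain_zero n j).trans
          (if_neg ((Finset.mem_range.1 hj).trans_le hn).ne)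
      rw [hzero, sub_zero, mul_one]
      exact (uniformChain_zero n n).trans_le (by simpa using hCi hn)
    · rw [uniformChain_zero, if_neg hni]
      exact mul_nonneg (mul_nonneg hC0 (sub_nonneg.2 hmass)) (hw.nonneg n)
  | succ k ih =>
    rw [uniformChain_succ]
    refine (hw.uniformStep_le hd hlt (uniformChain_nonneg hd i k) hCb (fun n hn => ih hn)
      hn).trans_eq ?_
    ring

lemma IsStationary.exists_uniformChain_le (hd : Q.IsEfficient d) (hw : Q.IsStationary d w)
    (i : ℕ) : ∃ C b, ∀ k n, b ≤ n → Q.uniformChain d i k n ≤ C * w n := by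
  obtain ⟨b, hlt, hpos⟩ := hw.exists_first_pos
  have hmin : 0 < min (w b) (w (max i b)) := lt_min (hpos b le_rfl) (hpos _ (le_max_right i b))
  set C := (min (w b) (w (max i b)))⁻¹
  have hC0 : 0 ≤ C := (inv_pos.2 hmin).le
  have hC : ∀ n, min (w b) (w (max i b)) ≤ w n → 1 ≤ C * w n := fun n hn =>
    (inv_mul_cancel₀ hmin.ne').symm.trans_le (mul_le_mul_of_nonneg_left hn hC0)
  refine ⟨C, b, fun k n hn => (hw.uniformChain_le hd hlt (hC b (min_le_left _ _))
    (fun hbi => hC i (by simp only [max_eq_left hbi, min_le_right])) hC0 k hn).trans ?_⟩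
  refine mul_le_mul_of_nonneg_right (mul_le_of_le_one_right hC0 ?_) (hw.nonneg n)
  exact sub_le_self _ (Finset.sum_nonneg fun j _ => uniformChain_nonneg hd i k j)

lemma IsStationary.exists_transition_le (hd : Q.IsEfficient d) (hw : Q.IsStationary d w) (i : ℕ) :
    ∃ W : ℕ → ℝ, (∀ t, 0 ≤ t → ∀ n, Q.transition d i t n ≤ W n) ∧ W =O[atTop] w := by
  obtain ⟨C, b, hC⟩ := hw.exists_uniformChain_le hd i
  refine ⟨fun n => if b ≤ n then C * w n else 1, fun t ht n => ?_, ?_⟩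
  · refine poissonMean_le (fun k => ?_) (mul_nonneg uniformRate_pos.le ht)
    beta_reduce
    split_ifs with h
    · exact (abs_of_nonneg (uniformChain_nonneg hd i k n)).trans_le (hC k n h)
    · exact abs_uniformChain_le_one hd i k n
  · refine (Asymptotics.isBigO_refl w atTop).const_mul_left C |>.congr' ?_ .rfl
    filter_upwards [eventually_ge_atTop b] with n hn using (if_pos hn).symm

end Domination

end GroupServerQueue

/-! ### Time averages and long-run average costs -/

section TimeAverage

open MeasureTheory

/-- The average of `φ` over the time interval from `0` to `T`; it is `0` for `T = 0`. -/
noncomputable def timeAverage (φ : ℝ → ℝ) (T : ℝ) : ℝ := T⁻¹ * ∫ t in (0 : ℝ)..T, φ t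

variable {φ : ℝ → ℝ} {T : ℝ}

lemma timeAverage_const (hT : T ≠ 0) (c : ℝ) : timeAverage (fun _ => c) T = c := by
  rw [timeAverage, intervalIntegral.integral_const, sub_zero, smul_eq_mul,
    inv_mul_cancel_left₀ hT]

lemma timeAverage_congr {ψ : ℝ → ℝ} (hT : 0 ≤ T) (h : ∀ t, 0 ≤ t → φ t = ψ t) :
    timeAverage φ T = timeAverage ψ T := by
  rw [timeAverage, timeAverage, intervalIntegral.integral_congr fun t ht =>
    h t (Set.uIcc_of_le hT ▸ ht).1]

lemma timeAverage_nonneg (hT : 0 ≤ T) (h : ∀ t, 0 ≤ t → 0 ≤ φ t) : 0 ≤ timeAverage φ T :=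
  mul_nonneg (inv_nonneg.2 hT) (intervalIntegral.integral_nonneg hT fun t ht => h t ht.1)

lemma timeAverage_le (hT : 0 < T) (hφ : IntervalIntegrable φ volume 0 T) {c : ℝ}
    (h : ∀ t, 0 ≤ t → φ t ≤ c) : timeAverage φ T ≤ c := by
  rw [← timeAverage_const hT.ne' c]
  exact mul_le_mul_of_nonneg_left (intervalIntegral.integral_mono_on hT.le hφ
    intervalIntegrable_const fun t ht => h t ht.1) (inv_nonneg.2 hT.le)

lemma intervalIntegrable_of_continuousOn_Ici (hφ : ContinuousOn φ (Set.Ici 0)) (hT : 0 ≤ T) :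
    IntervalIntegrable φ volume 0 T :=
  (hφ.mono (Set.uIcc_of_le hT ▸ Set.Icc_subset_Ici_self)).intervalIntegrable

end TimeAverage

namespace GroupServerQueue

open Filter Topology MeasureTheory

variable {K : ℕ} {Q : GroupServerQueue K} {d : ℕ → Fin K → ℕ} {w : ℕ → ℝ}

namespace IsLaw

variable {p : ℝ → ℕ → ℝ} {i : ℕ} {T : ℝ}

lemma continuousOn (hp : Q.IsLaw d i p) (n : ℕ) : ContinuousOn (p · n) (Set.Ici 0) :=
  fun t ht => (hp.kolmogorov t ht n).continuousWithinAt

lemma intervalIntegrable (hp : Q.IsLaw d i p) (hT : 0 ≤ T) (n : ℕ) :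
    IntervalIntegrable (p · n) volume 0 T :=
  intervalIntegrable_of_continuousOn_Ici (hp.continuousOn n) hT

lemma le_one (hp : Q.IsLaw d i p) {t : ℝ} (ht : 0 ≤ t) (n : ℕ) : p t n ≤ 1 :=
  le_hasSum (hp.hasSum_one t ht) n fun m _ => hp.nonneg t ht m

lemma integral_forward (hp : Q.IsLaw d i p) (hT : 0 ≤ T) (n : ℕ) :
    ∫ t in (0 : ℝ)..T, Q.forward d (p t) n = p T n - p 0 n := by
  have hcont : ContinuousOn (fun t => Q.forward d (p t) n) (Set.Ici 0) :=
    (continuous_apply n).comp_continuousOn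
      ((Q.forwardCLM d).continuous.comp_continuousOn (continuousOn_pi.2 hp.continuousOn))
  refine intervalIntegral.integral_eq_sub_of_hasDeriv_right
    ((hp.continuousOn n).mono (Set.uIcc_of_le hT ▸ Set.Icc_subset_Ici_self)) (fun t ht => ?_)
    (intervalIntegrable_of_continuousOn_Ici hcont hT)
  rw [min_eq_left hT] at ht
  exact (hp.kolmogorov t ht.1.le n).mono fun s hs => ht.1.le.trans (le_of_lt hs)

lemma forward_timeAverage (hp : Q.IsLaw d i p) (hT : 0 ≤ T) (n : ℕ) :
    Q.forward d (fun m => timeAverage (p · m) T) n = T⁻¹ * (p T n - p 0 n) := by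
  have hint : ∀ (c : ℝ) m, IntervalIntegrable (fun t => c * p t m) volume 0 T := fun c m =>
    (hp.intervalIntegrable hT m).const_mul c
  rw [← hp.integral_forward hT n]
  cases n with
  | zero =>
    simp only [forward, timeAverage]
    rw [intervalIntegral.integral_add (hint _ _) (hint _ _)]
    simp only [intervalIntegral.integral_const_mul]
    ring
  | succ n =>
    simp only [forward, timeAverage]
    rw [intervalIntegral.integral_add ((hint _ _).sub (hint _ _)) (hint _ _),
      intervalIntegral.integral_sub (hint _ _) (hint _ _)]
    simp only [intervalIntegral.integral_const_mul]
    ring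

lemma tendsto_forward_timeAverage (hp : Q.IsLaw d i p) (n : ℕ) :
    Tendsto (fun T => Q.forward d (fun m => timeAverage (p · m) T) n) atTop (𝓝 0) := by
  refine squeeze_zero_norm' ?_ tendsto_inv_atTop_zero
  filter_upwards [eventually_ge_atTop 0] with T hT
  rw [hp.forward_timeAverage hT, norm_mul, Real.norm_of_nonneg (inv_nonneg.2 hT)]
  refine mul_le_of_le_one_right (inv_nonneg.2 hT) (abs_sub_le_iff.2 ⟨?_, ?_⟩)
  · linarith [hp.le_one hT n, hp.nonneg 0 le_rfl n]
  · linarith [hp.le_one le_rfl n, hp.nonneg T hT n]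

lemma exists_tendsto_timeAverage (hp : Q.IsLaw d i p) (U : Ultrafilter ℝ)
    (hU : (U : Filter ℝ) ≤ atTop) :
    ∃ v : ℕ → ℝ, (∀ n, Tendsto (timeAverage (p · n)) U (𝓝 (v n))) ∧ (∀ n, 0 ≤ v n) ∧
      ∀ n, Q.serviceRate (d (n + 1)) * v (n + 1) = Q.arrival * v n := by
  have hlim : ∀ n, ∃ x ∈ Set.Icc (0 : ℝ) 1, Tendsto (timeAverage (p · n)) U (𝓝 x) := fun n => by
    refine isCompact_Icc.ultrafilter_le_nhds (U.map (timeAverage (p · n))) ?_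
    rw [Ultrafilter.coe_map, le_principal_iff, mem_map]
    filter_upwards [hU (eventually_gt_atTop 0)] with T hT
    exact ⟨timeAverage_nonneg (le_of_lt hT) fun t ht => hp.nonneg t ht n,
      timeAverage_le hT (hp.intervalIntegrable (le_of_lt hT) n) fun t ht => hp.le_one ht n⟩
  choose v hv01 hv using hlim
  refine ⟨v, hv, fun n => (hv01 n).1, balance_iff_forward_eq_zero.2 fun n => ?_⟩
  have hforward : Tendsto (fun T => Q.forward d (fun m => timeAverage (p · m) T) n) U
      (𝓝 (Q.forward d v n)) :=
    tendsto_pi_nhds.1 (((Q.forwardCLM d).continuous.tendsto v).comp (tendsto_pi_nhds.2 hv)) n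
  exact tendsto_nhds_unique hforward ((hp.tendsto_forward_timeAverage n).mono_left hU)

lemma hasSum_timeAverage_mul (hp : Q.IsLaw d i p) {g G : ℕ → ℝ} (hgG : ∀ n, |g n| ≤ G n)
    (hsum : ∀ t, 0 ≤ t → Summable fun n => p t n * G n) (hT : 0 ≤ T)
    (hint : IntervalIntegrable (fun t => ∑' n, p t n * G n) volume 0 T) :
    HasSum (fun n => timeAverage (p · n) T * g n)
      (timeAverage (fun t => ∑' n, p t n * g n) T) := by
  have hmem : ∀ t ∈ Set.uIoc 0 T, 0 ≤ t := fun t ht => (Set.uIoc_of_le hT ▸ ht).1.le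
  have hbound : ∀ n t, 0 ≤ t → ‖p t n * g n‖ ≤ p t n * G n := fun n t ht => by
    rw [norm_mul, Real.norm_of_nonneg (hp.nonneg t ht n)]
    exact mul_le_mul_of_nonneg_left (hgG n) (hp.nonneg t ht n)
  have hintegral := intervalIntegral.hasSum_integral_of_dominated_convergence
    (fun n t => p t n * G n)
    (fun n => ((hp.intervalIntegrable hT n).mul_const (g n)).def'.aestronglyMeasurable)
    (fun n => .of_forall fun t ht => hbound n t (hmem t ht))
    (.of_forall fun t ht => hsum t (hmem t ht)) hint
    (.of_forall fun t ht => (Summable.of_norm_bounded (hsum t (hmem t ht))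
      fun n => hbound n t (hmem t ht)).hasSum)
  simpa only [intervalIntegral.integral_mul_const, timeAverage, mul_assoc] using
    hintegral.mul_left T⁻¹

lemma hasSum_timeAverage (hp : Q.IsLaw d i p) (hT : 0 < T) :
    HasSum (fun n => timeAverage (p · n) T) 1 := by
  have hone : ∀ t, 0 ≤ t → ∑' n, p t n * 1 = 1 := fun t ht => by
    simpa using (hp.hasSum_one t ht).tsum_eq
  have hint : IntervalIntegrable (fun t => ∑' n, p t n * 1) volume 0 T :=
    intervalIntegrable_of_continuousOn_Ici (continuousOn_const.congr hone) hT.le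
  have hmass := hp.hasSum_timeAverage_mul (fun _ => abs_one.le)
    (fun t ht => by simpa using (hp.hasSum_one t ht).summable) hT.le hint
  rw [timeAverage_congr hT.le hone, timeAverage_const hT.ne'] at hmass
  simpa only [mul_one] using hmass

lemma tendsto_timeAverage (hp : Q.IsLaw d i p) (hw : Q.IsStationary d w) {W : ℕ → ℝ}
    (hW : Summable W) (hpW : ∀ t, 0 ≤ t → ∀ n, p t n ≤ W n) (n : ℕ) :
    Tendsto (timeAverage (p · n)) atTop (𝓝 (w n)) := by
  rw [tendsto_iff_ultrafilter]
  intro U hU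
  obtain ⟨v, hv, hv0, hbalance⟩ := hp.exists_tendsto_timeAverage U hU
  have hpos : ∀ᶠ T in (U : Filter ℝ), 0 < T := hU (eventually_gt_atTop 0)
  have hle : ∀ᶠ T in (U : Filter ℝ), ∀ n, ‖timeAverage (p · n) T‖ ≤ W n := by
    filter_upwards [hpos] with T hT n
    rw [Real.norm_of_nonneg (timeAverage_nonneg hT.le fun t ht => hp.nonneg t ht n)]
    exact timeAverage_le hT (hp.intervalIntegrable hT.le n) fun t ht => hpW t ht n
  have hmass : ∑' n, v n = 1 :=
    tendsto_nhds_unique (tendsto_tsum_of_dominated_convergence hW hv hle) <|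
      tendsto_const_nhds.congr' <| hpos.mono fun T hT => (hp.hasSum_timeAverage hT).tsum_eq.symm
  have hv_sum : Summable v := .of_nonneg_of_le hv0 (fun n => le_of_tendsto (hv n) <|
    hle.mono fun T hT => (le_abs_self _).trans (hT n)) hW
  have hv_stationary : Q.IsStationary d v := ⟨hv0, hmass ▸ hv_sum.hasSum, hbalance⟩
  exact hw.unique hv_stationary ▸ hv n

end IsLaw

theorem IsStationary.hasAverageCost (hd : Q.IsEfficient d) (hw : Q.IsStationary d w)
    {η : ℝ} (hη : HasSum (fun n => w n * Q.costRate n (d n)) η) : Q.HasAverageCost d η := by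
  intro i
  set f := fun n => Q.costRate n (d n)
  obtain ⟨W, hpW, hWw⟩ := hw.exists_transition_le hd i
  have hp := isLaw_transition hd i
  have hW : Summable W := summable_of_isBigO_nat hw.hasSum_one.summable hWw
  have hWf : Summable fun n => W n * |f n| :=
    summable_of_isBigO_nat hη.summable (hWw.mul (Asymptotics.isBigO_refl f atTop).abs_left)
  have hbound : ∀ {g : ℕ → ℝ}, (∀ n, |g n| = |f n|) → ∀ n, ∀ t ∈ Set.Ici (0 : ℝ),
      ‖Q.transition d i t n * g n‖ ≤ W n * |f n| := fun hg n t ht => by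
    rw [norm_mul, Real.norm_of_nonneg (hp.nonneg t ht n), Real.norm_eq_abs, hg]
    exact mul_le_mul_of_nonneg_right (hpW t ht n) (abs_nonneg _)
  have hcont : ∀ {g : ℕ → ℝ}, (∀ n, |g n| = |f n|) →
      ContinuousOn (fun t => ∑' n, Q.transition d i t n * g n) (Set.Ici 0) := fun hg =>
    continuousOn_tsum (fun n => (hp.continuousOn n).mul continuousOn_const) hWf (hbound hg)
  refine ⟨Q.transition d i, hp, fun t ht => .of_norm_bounded hWf fun n => hbound (fun _ => rfl)
    n t ht, fun T hT => intervalIntegrable_of_continuousOn_Ici (hcont fun _ => rfl) hT, ?_⟩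
  refine hη.tsum_eq ▸ (tendsto_tsum_of_dominated_convergence hWf (fun n =>
    (hp.tendsto_timeAverage hw hW hpW n).mul_const (f n)) ?_).congr' ?_
  · filter_upwards [eventually_gt_atTop 0] with T hT n
    rw [norm_mul, Real.norm_of_nonneg (timeAverage_nonneg hT.le fun t ht => hp.nonneg t ht n)]
    exact mul_le_mul_of_nonneg_right
      (timeAverage_le hT (hp.intervalIntegrable hT.le n) fun t ht => hpW t ht n) (abs_nonneg _)
  · filter_upwards [eventually_ge_atTop 0] with T hT
    exact (hp.hasSum_timeAverage_mul (fun n => le_rfl)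
      (fun t ht => .of_norm_bounded hWf fun n => hbound (fun _ => abs_abs _) n t ht) hT
      (intervalIntegrable_of_continuousOn_Ici (hcont fun _ => abs_abs _) hT)).tsum_eq

lemma hold_le_costRate (n : ℕ) (m : Fin K → ℕ) : Q.hold n ≤ Q.costRate n m :=
  le_add_of_nonneg_right (Finset.sum_nonneg fun k _ =>
    mul_nonneg (Nat.cast_nonneg _) (Q.opCost_nonneg k))

theorem HasAverageCost.exists_isStationary (hhold : Tendsto Q.hold atTop atTop) {η : ℝ}
    (h : Q.HasAverageCost d η) :
    ∃ w, Q.IsStationary d w ∧ ∃ η' ≤ η, HasSum (fun n => w n * Q.costRate n (d n)) η' := by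
  obtain ⟨p, hp, hsum, hint, hη⟩ := h 0
  have hcost : Tendsto (fun n => Q.costRate n (d n)) cofinite atTop :=
    Nat.cofinite_eq_atTop ▸ tendsto_atTop_mono (fun n => hold_le_costRate n _) hhold
  obtain ⟨c, hc⟩ := exists_forall_le_of_tendsto_cofinite hcost
  have hmean : ∀ T, 0 < T → HasSum (fun n => timeAverage (p · n) T * Q.costRate n (d n))
      (timeAverage (fun t => ∑' n, p t n * Q.costRate n (d n)) T) := fun T hT => by
    have habs : ∀ n, |Q.costRate n (d n)| ≤ Q.costRate n (d n) + 2 * |c| := fun n =>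
      abs_le.2 ⟨by linarith [hc n, neg_abs_le c], by linarith [abs_nonneg c]⟩
    have hG : ∀ t, 0 ≤ t → HasSum (fun n => p t n * (Q.costRate n (d n) + 2 * |c|))
        (∑' n, p t n * Q.costRate n (d n) + 2 * |c|) := fun t ht => by
      simpa only [mul_add, one_mul] using
        (hsum t ht).hasSum.add ((hp.hasSum_one t ht).mul_right (2 * |c|))
    refine hp.hasSum_timeAverage_mul habs (fun t ht => (hG t ht).summable) hT.le ?_
    refine ((hint T hT.le).add (intervalIntegrable_const (c := 2 * |c|))).congr fun t ht => ?_
    exact (hG t (Set.uIoc_of_le hT.le ▸ ht).1.le).tsum_eq.symm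
  set U : Ultrafilter ℝ := .of atTop
  have hU : (U : Filter ℝ) ≤ atTop := Ultrafilter.of_le atTop
  obtain ⟨w, hw, hw0, hbalance⟩ := hp.exists_tendsto_timeAverage U hU
  have hpos : ∀ᶠ T in (U : Filter ℝ), 0 < T := hU (eventually_gt_atTop 0)
  have hnonneg : ∀ᶠ T in (U : Filter ℝ), ∀ n, 0 ≤ timeAverage (p · n) T :=
    hpos.mono fun T hT n => timeAverage_nonneg hT.le fun t ht => hp.nonneg t ht n
  have hmass := hpos.mono fun T hT => hp.hasSum_timeAverage hT
  have hη := hη.mono_left hU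
  exact ⟨w, ⟨hw0, hasSum_one_of_tendsto hnonneg hmass hw hcost (hpos.mono hmean) hη, hbalance⟩,
    exists_hasSum_mul_le_of_tendsto hnonneg hmass hw hcost (hpos.mono hmean) hη⟩

end GroupServerQueue

/-! ### Performance differences -/

namespace GroupServerQueue

open Filter Topology

variable {K : ℕ} (Q : GroupServerQueue K)

/-- The rate at which the working servers of the action `m` save costs, if every departure saves
the amount `x`. -/
noncomputable def gain (m : Fin K → ℕ) (x : ℝ) : ℝ :=
  ∑ k, (m k : ℝ) * (Q.rate k * x - Q.opCost k)

/-- The efficient actions in state `n`. -/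
def feasibleActions (n : ℕ) : Finset (Fin K → ℕ) :=
  (Fintype.piFinset fun k => Finset.range (Q.servers k + 1)).filter fun m => ∑ k, m k ≤ n

/-- The action `m` has the largest gain of all efficient actions in state `n`, if every departure
saves the amount `x`. -/
def IsMaximizer (n : ℕ) (x : ℝ) (m : Fin K → ℕ) : Prop :=
  m ∈ Q.feasibleActions n ∧ ∀ m' ∈ Q.feasibleActions n, Q.gain m' x ≤ Q.gain m x

/-- The performance potentials (relative values) `V` of the policy `d`, whose average cost is `η`,
enter through their differences: `valueDiff d η (n + 1) = V (n + 1) - V n`, as determined by the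
Poisson equation for `V`. The value at `0` is a dummy, since nobody can depart in state `0`. -/
noncomputable def valueDiff (d : ℕ → Fin K → ℕ) (η : ℝ) : ℕ → ℝ
  | 0 => 0
  | n + 1 => (η - Q.hold n + Q.gain (d n) (valueDiff d η n)) / Q.arrival

variable {Q} {d d' : ℕ → Fin K → ℕ} {v w : ℕ → ℝ} {η : ℝ} {n N : ℕ} {m : Fin K → ℕ}

lemma mem_feasibleActions :
    m ∈ Q.feasibleActions n ↔ (∀ k, m k ≤ Q.servers k) ∧ ∑ k, m k ≤ n := by
  simp [feasibleActions]

lemma zero_mem_feasibleActions (n : ℕ) : 0 ∈ Q.feasibleActions n := by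
  simp [mem_feasibleActions]

lemma gain_eq (n : ℕ) (m : Fin K → ℕ) (x : ℝ) :
    Q.gain m x = Q.serviceRate m * x - (Q.costRate n m - Q.hold n) := by
  simp only [gain, serviceRate, costRate, add_sub_cancel_left, Finset.sum_mul,
    ← Finset.sum_sub_distrib, mul_sub, mul_assoc]

lemma gain_zero (x : ℝ) : Q.gain 0 x = 0 := by simp [gain]

lemma gain_mono (m : Fin K → ℕ) : Monotone (Q.gain m) := fun _ _ hxy =>
  Finset.sum_le_sum fun k _ => mul_le_mul_of_nonneg_left
    (sub_le_sub_right (mul_le_mul_of_nonneg_left hxy (Q.rate_pos k).le) _) (Nat.cast_nonneg _)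

lemma arrival_mul_valueDiff (n : ℕ) : Q.arrival * Q.valueDiff d η (n + 1)
    = η - Q.hold n + Q.gain (d n) (Q.valueDiff d η n) := by
  rw [valueDiff, mul_div_cancel₀ _ Q.arrival_pos.ne']

/- The Poisson equation of `d`, integrated against balanced weights of `d'`: all terms telescope
except those that compare the two actions in a state, and the boundary term. -/
lemma sum_range_mul_costRate_sub
    (hv : ∀ n, Q.serviceRate (d' (n + 1)) * v (n + 1) = Q.arrival * v n) (N : ℕ) :
    ∑ j ∈ Finset.range (N + 1), v j * (Q.costRate j (d' j) - η)
      = ∑ j ∈ Finset.range (N + 1), v j * (Q.gain (d j) (Q.valueDiff d η j)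
          - Q.gain (d' j) (Q.valueDiff d η j))
        - v N * (Q.arrival * Q.valueDiff d η (N + 1)) := by
  induction N with
  | zero =>
    rw [arrival_mul_valueDiff]
    simp only [zero_add, Finset.sum_range_one, valueDiff, gain_eq 0]
    ring
  | succ N ih =>
    rw [Finset.sum_range_succ, ih, Finset.sum_range_succ _ (N + 1), arrival_mul_valueDiff (N + 1),
      gain_eq (N + 1) (d' (N + 1))]
    linear_combination (Q.valueDiff d η (N + 1)) * hv N

namespace IsStationary

lemma hasSum_mul_costRate_sub (hw : Q.IsStationary d w)
    (hη : HasSum (fun n => w n * Q.costRate n (d n)) η) (c : ℝ) :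
    HasSum (fun n => w n * (Q.costRate n (d n) - c)) (η - c) := by
  simpa only [mul_sub, one_mul] using hη.sub (hw.hasSum_one.mul_right c)

lemma sum_range_mul_costRate_sub_self (hw : Q.IsStationary d w) (N : ℕ) :
    ∑ j ∈ Finset.range (N + 1), w j * (Q.costRate j (d j) - η)
      = -(w N * (Q.arrival * Q.valueDiff d η (N + 1))) := by
  rw [sum_range_mul_costRate_sub (d := d) hw.balance]
  simp only [sub_self, mul_zero, Finset.sum_const_zero, zero_sub]

lemma tendsto_mul_valueDiff (hw : Q.IsStationary d w)
    (hη : HasSum (fun n => w n * Q.costRate n (d n)) η) :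
    Tendsto (fun N => w N * (Q.arrival * Q.valueDiff d η (N + 1))) atTop (𝓝 0) := by
  have hsum := hw.hasSum_mul_costRate_sub hη η
  rw [sub_self] at hsum
  simpa only [hw.sum_range_mul_costRate_sub_self, neg_neg, neg_zero] using
    ((tendsto_add_atTop_iff_nat 1).2 hsum.tendsto_sum_nat).neg

lemma eventually_valueDiff_nonneg (hhold : Tendsto Q.hold atTop atTop) (hw : Q.IsStationary d w)
    (hη : HasSum (fun n => w n * Q.costRate n (d n)) η) :
    ∀ᶠ n in atTop, 0 ≤ Q.valueDiff d η (n + 1) := by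
  obtain ⟨b, -, hb⟩ := hw.exists_first_pos
  obtain ⟨N, hN⟩ := eventually_atTop.1 (hhold.eventually_ge_atTop η)
  have hterm : ∀ n, N ≤ n → 0 ≤ w n * (Q.costRate n (d n) - η) := fun n hn =>
    mul_nonneg (hw.nonneg n) (sub_nonneg.2 ((hN n hn).trans (hold_le_costRate n _)))
  filter_upwards [eventually_ge_atTop N, eventually_ge_atTop b] with n hNn hbn
  have hpartial : ∑ j ∈ Finset.range (n + 1), w j * (Q.costRate j (d j) - η) ≤ η - η :=
    sum_le_hasSum _ (fun j hj => hterm j <|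
      hNn.trans (Nat.le_of_succ_le (by simpa using hj))) (hw.hasSum_mul_costRate_sub hη η)
  rw [hw.sum_range_mul_costRate_sub_self, sub_self, neg_nonpos] at hpartial
  exact nonneg_of_mul_nonneg_right (nonneg_of_mul_nonneg_right hpartial (hb n hbn)) Q.arrival_pos

end IsStationary

lemma exists_isStationary_mul_of_balance (hv0 : ∀ n, 0 ≤ v n) (hv : Summable v) (hN : 0 < v N)
    (hbalance : ∀ n, Q.serviceRate (d (n + 1)) * v (n + 1) = Q.arrival * v n) :
    ∃ c, 0 < c ∧ Q.IsStationary d fun n => c * v n := by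
  have hpos : 0 < ∑' n, v n := hv.tsum_pos hv0 N hN
  refine ⟨(∑' n, v n)⁻¹, inv_pos.2 hpos, fun n => mul_nonneg (inv_nonneg.2 hpos.le) (hv0 n),
    ?_, fun n => ?_⟩
  · simpa only [inv_mul_cancel₀ hpos.ne'] using hv.hasSum.mul_left (∑' n, v n)⁻¹
  · rw [mul_left_comm, hbalance, mul_left_comm]

/- Below `N`, the balance equations of `d'` are solved downwards from the value `w N`. -/
lemma IsStationary.exists_of_serviceRate_eq (hw : Q.IsStationary d w) (hN : 0 < w N)
    (hrate : ∀ n, N < n → Q.serviceRate (d' n) = Q.serviceRate (d n)) :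
    ∃ v c, Q.IsStationary d' v ∧ 0 < c ∧ ∀ n, N ≤ n → v n = c * w n := by
  set u : ℕ → ℝ := fun n =>
    (∏ j ∈ Finset.Ico n N, Q.serviceRate (d' (j + 1)) / Q.arrival) * w (max n N)
  have huN : ∀ n, N ≤ n → u n = w n := fun n hn => by
    simp only [u, Finset.Ico_eq_empty_of_le hn, Finset.prod_empty, one_mul, max_eq_left hn]
  have hu0 : ∀ n, 0 ≤ u n := fun n => mul_nonneg
    (Finset.prod_nonneg fun j _ => div_nonneg (serviceRate_nonneg _) Q.arrival_pos.le)
    (hw.nonneg _)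
  have hu : Summable u := (summable_nat_add_iff N).1 <|
    ((summable_nat_add_iff N).2 hw.hasSum_one.summable).congr fun n =>
      (huN _ (Nat.le_add_left N n)).symm
  have hbalance : ∀ n, Q.serviceRate (d' (n + 1)) * u (n + 1) = Q.arrival * u n := fun n => by
    rcases le_or_gt N n with hn | hn
    · rw [huN n hn, huN (n + 1) (by omega), hrate (n + 1) (by omega), hw.balance]
    · have := Q.arrival_pos.ne'
      simp only [u, Finset.prod_eq_prod_Ico_succ_bot hn, max_eq_right hn.le,
        max_eq_right (Nat.succ_le_of_lt hn)]
      field_simp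
  obtain ⟨c, hc, hv⟩ := exists_isStationary_mul_of_balance hu0 hu ((huN N le_rfl).symm ▸ hN)
    hbalance
  exact ⟨_, c, hv, hc, fun n hn => congrArg _ (huN n hn)⟩

theorem IsStationary.exists_performance_difference (hw : Q.IsStationary d w)
    (hη : HasSum (fun n => w n * Q.costRate n (d n)) η) (hN : 0 < w N)
    (hrate : ∀ n, N < n → Q.serviceRate (d' n) = Q.serviceRate (d n))
    (hcost : ∀ n, N < n → Q.costRate n (d' n) = Q.costRate n (d n)) :
    ∃ v η', Q.IsStationary d' v ∧ HasSum (fun n => v n * Q.costRate n (d' n)) η' ∧ 0 < v N ∧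
      η' - η = ∑ j ∈ Finset.range (N + 1),
        v j * (Q.gain (d j) (Q.valueDiff d η j) - Q.gain (d' j) (Q.valueDiff d η j)) := by
  obtain ⟨v, c, hv, hc, hvw⟩ := hw.exists_of_serviceRate_eq hN hrate
  have hsum : Summable fun n => v n * Q.costRate n (d' n) :=
    (summable_nat_add_iff (N + 1)).1 <|
      (((summable_nat_add_iff (N + 1)).2 hη.summable).mul_left c).congr fun n => by
        rw [hvw _ (by omega), hcost _ (by omega), mul_assoc]
  have hzero : ∀ j ∉ Finset.range (N + 1), v j * (Q.gain (d j) (Q.valueDiff d η j)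
      - Q.gain (d' j) (Q.valueDiff d η j)) = 0 := fun j hj => by
    have hj : N < j := by simpa using hj
    rw [gain_eq j, gain_eq j, hrate j hj, hcost j hj, sub_self, mul_zero]
  have hboundary : Tendsto (fun M => v M * (Q.arrival * Q.valueDiff d η (M + 1))) atTop (𝓝 0) := by
    refine (mul_zero c ▸ (hw.tendsto_mul_valueDiff hη).const_mul c).congr' ?_
    filter_upwards [eventually_ge_atTop N] with M hM
    rw [hvw M hM, mul_assoc]
  refine ⟨v, _, hv, hsum.hasSum, by rw [hvw N le_rfl]; exact mul_pos hc hN, ?_⟩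
  have hcosts := (tendsto_add_atTop_iff_nat 1).2
    (hv.hasSum_mul_costRate_sub hsum.hasSum η).tendsto_sum_nat
  have hgains := ((tendsto_add_atTop_iff_nat 1).2
    (hasSum_sum_of_ne_finset_zero hzero).tendsto_sum_nat).sub hboundary
  rw [sub_zero] at hgains
  exact tendsto_nhds_unique hcosts
    (hgains.congr fun M => (sum_range_mul_costRate_sub hv.balance M).symm)

variable (Q d w η) in
/-- The policy `d` is efficient, and it has the stationary distribution `w` and the stationary mean
cost `η`, which is the smallest one of all efficient policies. -/
structure IsOptimalWith : Prop where
  efficient : Q.IsEfficient d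
  stationary : Q.IsStationary d w
  hasSum : HasSum (fun n => w n * Q.costRate n (d n)) η
  le : ∀ d' w' η', Q.IsEfficient d' → Q.IsStationary d' w' →
    HasSum (fun n => w' n * Q.costRate n (d' n)) η' → η ≤ η'

lemma IsOptimal.exists_isOptimalWith (hhold : Tendsto Q.hold atTop atTop) (h : Q.IsOptimal d) :
    ∃ w η, Q.IsOptimalWith d w η := by
  obtain ⟨hd, η, hη, hmin⟩ := h
  obtain ⟨w, hw, η', hle, hη'⟩ := hη.exists_isStationary hhold
  exact ⟨w, η', hd, hw, hη', fun d'' w'' η'' hd'' hw'' hη'' =>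
    hle.trans (hmin d'' η'' hd'' (hw''.hasAverageCost hd'' hη''))⟩

namespace IsOptimalWith

lemma isOptimal (hhold : Tendsto Q.hold atTop atTop) (h : Q.IsOptimalWith d w η) :
    Q.IsOptimal d := by
  refine ⟨h.efficient, η, h.stationary.hasAverageCost h.efficient h.hasSum,
    fun d' η' hd' hη' => ?_⟩
  obtain ⟨w', hw', η'', hle, hη''⟩ := hη'.exists_isStationary hhold
  exact (h.le d' w' η'' hd' hw' hη'').trans hle

theorem isMaximizer_of_pos (h : Q.IsOptimalWith d w η) (hn : 0 < w n) :
    Q.IsMaximizer n (Q.valueDiff d η n) (d n) := by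
  refine ⟨mem_feasibleActions.2 (h.efficient n), fun m hm => ?_⟩
  have hne : ∀ j ≠ n, Function.update d n m j = d j := fun j hj => Function.update_of_ne hj _ _
  obtain ⟨v, η', hv, hη', hvn, hdiff⟩ := h.stationary.exists_performance_difference
    (d' := Function.update d n m) h.hasSum hn
    (fun j hj => by rw [hne j hj.ne']) (fun j hj => by rw [hne j hj.ne'])
  have hefficient : Q.IsEfficient (Function.update d n m) := fun j => by
    rcases eq_or_ne j n with rfl | hj
    · simpa only [Function.update_self] using mem_feasibleActions.1 hm
    · simpa only [hne j hj] using h.efficient j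
  rw [Finset.sum_range_succ, Finset.sum_eq_zero fun j hj => by
    rw [hne j (Finset.mem_range.1 hj).ne, sub_self, mul_zero], Function.update_self,
    zero_add] at hdiff
  have hle : 0 ≤ η' - η := sub_nonneg.2 (h.le _ v η' hefficient hv hη')
  exact sub_nonneg.1 (nonneg_of_mul_nonneg_right (hdiff ▸ hle) hvn)

lemma idle_below (h : Q.IsOptimalWith d w η) {b : ℕ} (hlt : ∀ n < b, w n = 0) (hb : 0 < w b) :
    Q.IsOptimalWith (fun n => if n ≤ b then 0 else d n) w η := by
  have hdb : d b = 0 :=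
    serviceRate_eq_zero_iff.1 (h.stationary.serviceRate_first_pos h.efficient hlt hb)
  refine ⟨fun n => ?_, ⟨h.stationary.nonneg, h.stationary.hasSum_one, fun n => ?_⟩, ?_, h.le⟩
  · split_ifs
    · exact mem_feasibleActions.1 (zero_mem_feasibleActions n)
    · exact h.efficient n
  · split_ifs with hn
    · rw [hlt n hn, serviceRate_eq_zero_iff.2 rfl, zero_mul, mul_zero]
    · exact h.stationary.balance n
  · refine h.hasSum.congr_fun fun n => ?_
    rcases lt_trichotomy n b with hn | rfl | hn
    · rw [hlt n hn, zero_mul, zero_mul]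
    · rw [if_pos le_rfl, hdb]
    · rw [if_neg hn.not_ge]

end IsOptimalWith

end GroupServerQueue

/-! ### The optimality equation -/

section AddSingle

variable {ι : Type*} [DecidableEq ι] {m : ι → ℕ} {i : ι}

lemma sum_add_single_mul {R : Type*} [Semiring R] [Fintype ι] (m : ι → ℕ) (i : ι) (f : ι → R) :
    ∑ j, ((m + Pi.single i 1 : ι → ℕ) j : R) * f j = ∑ j, (m j : R) * f j + f i := by
  simp [add_mul, Finset.sum_add_distrib, Pi.single_apply]

lemma sum_add_single [Fintype ι] (m : ι → ℕ) (i : ι) :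
    ∑ j, (m + Pi.single i 1 : ι → ℕ) j = ∑ j, m j + 1 := by
  simpa using sum_add_single_mul m i fun _ => (1 : ℕ)

lemma exists_eq_add_single (hi : 0 < m i) : ∃ m' : ι → ℕ, m = m' + Pi.single i 1 :=
  ⟨m - Pi.single i 1, (tsub_add_cancel_of_le (update_le_iff.2 ⟨hi, fun _ _ => Nat.zero_le _⟩)).symm⟩

end AddSingle

namespace GroupServerQueue

open Filter Topology

variable {K : ℕ} {Q : GroupServerQueue K} {d : ℕ → Fin K → ℕ} {w : ℕ → ℝ} {η : ℝ} {n : ℕ}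
  {m : Fin K → ℕ} {k : Fin K} {x y : ℝ}

lemma gain_add_single (m : Fin K → ℕ) (k : Fin K) (x : ℝ) :
    Q.gain (m + Pi.single k 1) x = Q.gain m x + (Q.rate k * x - Q.opCost k) :=
  sum_add_single_mul m k fun j => Q.rate j * x - Q.opCost j

lemma add_single_mem_feasibleActions (hm : m ∈ Q.feasibleActions n) (hk : m k < Q.servers k) :
    m + Pi.single k 1 ∈ Q.feasibleActions (n + 1) := by
  obtain ⟨hservers, hcard⟩ := mem_feasibleActions.1 hm
  refine mem_feasibleActions.2 ⟨fun j => ?_, sum_add_single m k ▸ Nat.succ_le_succ hcard⟩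
  rcases eq_or_ne j k with rfl | hj
  · simpa using hk
  · simpa [hj] using hservers j

lemma mem_feasibleActions_of_add_single
    (hm : m + Pi.single k 1 ∈ Q.feasibleActions (n + 1)) : m ∈ Q.feasibleActions n := by
  obtain ⟨hservers, hcard⟩ := mem_feasibleActions.1 hm
  rw [sum_add_single] at hcard
  exact mem_feasibleActions.2
    ⟨fun j => (Nat.le_add_right _ _).trans (hservers j), Nat.le_of_succ_le_succ hcard⟩

variable (Q) in
/-- The largest gain of an efficient action in state `n`, if every departure saves the amount
`x`. -/
noncomputable def maxGain (n : ℕ) (x : ℝ) : ℝ :=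
  (Q.feasibleActions n).sup' ⟨0, zero_mem_feasibleActions n⟩ fun m => Q.gain m x

lemma gain_le_maxGain (hm : m ∈ Q.feasibleActions n) : Q.gain m x ≤ Q.maxGain n x :=
  Finset.le_sup' (Q.gain · x) hm

lemma exists_gain_eq_maxGain (n : ℕ) (x : ℝ) :
    ∃ m ∈ Q.feasibleActions n, Q.maxGain n x = Q.gain m x :=
  Finset.exists_mem_eq_sup' _ (Q.gain · x)

lemma IsMaximizer.maxGain_eq (h : Q.IsMaximizer n x m) : Q.maxGain n x = Q.gain m x :=
  le_antisymm (Finset.sup'_le _ _ h.2) (gain_le_maxGain h.1)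

lemma maxGain_nonneg (n : ℕ) (x : ℝ) : 0 ≤ Q.maxGain n x :=
  gain_zero (Q := Q) x ▸ gain_le_maxGain (zero_mem_feasibleActions n)

lemma maxGain_mono (n : ℕ) : Monotone (Q.maxGain n) := fun _ _ hxy =>
  Finset.sup'_le _ _ fun m hm => (gain_mono m hxy).trans (gain_le_maxGain hm)

lemma maxGain_zero (x : ℝ) : Q.maxGain 0 x = 0 := by
  obtain ⟨m, hm, h⟩ := exists_gain_eq_maxGain (Q := Q) 0 x
  have hm0 : m = 0 := by simpa [funext_iff] using (mem_feasibleActions.1 hm).2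
  rw [h, hm0, gain_zero]

lemma maxGain_le (n : ℕ) (x : ℝ) :
    Q.maxGain n x ≤ ∑ k, (Q.servers k : ℝ) * |Q.rate k * x - Q.opCost k| :=
  Finset.sup'_le _ _ fun _ hm => Finset.sum_le_sum fun k _ =>
    (mul_le_mul_of_nonneg_left (le_abs_self _) (Nat.cast_nonneg _)).trans <|
      mul_le_mul_of_nonneg_right (Nat.cast_le.2 ((mem_feasibleActions.1 hm).1 k)) (abs_nonneg _)

/- If the maximizer for `n + 2` uses all customers, then it keeps some server busier than the
maximizer for `n` does; that server can be moved from the former action to the latter. -/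
lemma maxGain_add_maxGain_le (n : ℕ) (hxy : x ≤ y) :
    Q.maxGain (n + 2) x + Q.maxGain n y ≤ Q.maxGain (n + 1) x + Q.maxGain (n + 1) y := by
  obtain ⟨m, hm, hmx⟩ := exists_gain_eq_maxGain (Q := Q) (n + 2) x
  obtain ⟨l, hl, hly⟩ := exists_gain_eq_maxGain (Q := Q) n y
  obtain ⟨hmservers, hmcard⟩ := mem_feasibleActions.1 hm
  obtain ⟨hlservers, hlcard⟩ := mem_feasibleActions.1 hl
  rw [hmx, hly]
  rcases le_or_gt (∑ k, m k) (n + 1) with hcard | hcard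
  · exact add_le_add (gain_le_maxGain (mem_feasibleActions.2 ⟨hmservers, hcard⟩))
      (gain_le_maxGain (mem_feasibleActions.2 ⟨hlservers, Nat.le_succ_of_le hlcard⟩))
  · obtain ⟨k, -, hk⟩ := Finset.exists_lt_of_sum_lt (show ∑ k, l k < ∑ k, m k by omega)
    obtain ⟨m', rfl⟩ := exists_eq_add_single (Nat.zero_lt_of_lt hk)
    have hremove : Q.gain m' x ≤ Q.maxGain (n + 1) x :=
      gain_le_maxGain (mem_feasibleActions_of_add_single hm)
    have hinsert : Q.gain (l + Pi.single k 1) y ≤ Q.maxGain (n + 1) y :=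
      gain_le_maxGain (add_single_mem_feasibleActions hl (hk.trans_le (hmservers k)))
    rw [gain_add_single] at hinsert ⊢
    linarith [mul_le_mul_of_nonneg_left hxy (Q.rate_pos k).le]

variable (Q) in
/-- The optimality equation of average cost `η` for the differences `G (n + 1) = V (n + 1) - V n`
of the performance potentials, in the states `n > b`. -/
def OptimalityEquation (η : ℝ) (b : ℕ) (G : ℕ → ℝ) : Prop :=
  ∀ n, b < n → Q.arrival * G (n + 1) = η - Q.hold n + Q.maxGain n (G n)

namespace OptimalityEquation

variable {G : ℕ → ℝ} {b : ℕ}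

lemma mono (hG : Q.OptimalityEquation η b G) {c : ℕ} (hbc : b ≤ c) : Q.OptimalityEquation η c G :=
  fun n hn => hG n (hbc.trans_lt hn)

lemma succ_le_succ (hG : Q.OptimalityEquation η b G)
    (hconvex : ∀ n, Q.hold (n + 1) - Q.hold n ≤ Q.hold (n + 2) - Q.hold (n + 1))
    (hle : G (b + 2) ≤ G (b + 1))
    (hmarginal : Q.maxGain (b + 1) (G (b + 1)) - Q.maxGain b (G (b + 1))
      ≤ Q.hold (b + 1) - Q.hold b) :
    G (b + 3) ≤ G (b + 2) ∧ Q.maxGain (b + 2) (G (b + 2)) - Q.maxGain (b + 1) (G (b + 2))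
      ≤ Q.hold (b + 2) - Q.hold (b + 1) := by
  have hexchange := maxGain_add_maxGain_le (Q := Q) b hle
  have hmono := maxGain_mono (Q := Q) (b + 1) hle
  have hnext : Q.maxGain (b + 2) (G (b + 2)) - Q.maxGain (b + 1) (G (b + 2))
      ≤ Q.hold (b + 2) - Q.hold (b + 1) := by linarith [hconvex b]
  refine ⟨le_of_mul_le_mul_left ?_ Q.arrival_pos, hnext⟩
  linarith [hG (b + 1) (by omega), hG (b + 2) (by omega)]

lemma antitone (hG : Q.OptimalityEquation η b G)
    (hconvex : ∀ n, Q.hold (n + 1) - Q.hold n ≤ Q.hold (n + 2) - Q.hold (n + 1))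
    (hle : G (b + 2) ≤ G (b + 1))
    (hmarginal : Q.maxGain (b + 1) (G (b + 1)) - Q.maxGain b (G (b + 1))
      ≤ Q.hold (b + 1) - Q.hold b) : Antitone fun j => G (b + j + 1) := by
  have hstep : ∀ j, G (b + j + 2) ≤ G (b + j + 1) ∧
      Q.maxGain (b + j + 1) (G (b + j + 1)) - Q.maxGain (b + j) (G (b + j + 1))
        ≤ Q.hold (b + j + 1) - Q.hold (b + j) := fun j => by
    induction j with
    | zero => exact ⟨hle, hmarginal⟩
    | succ j ih => exact (hG.mono (Nat.le_add_right b j)).succ_le_succ hconvex ih.1 ih.2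
  exact antitone_nat_of_succ_le fun j => (hstep j).1

lemma not_antitone (hG : Q.OptimalityEquation η b G) (hhold : Tendsto Q.hold atTop atTop)
    (hnonneg : ∀ᶠ n in atTop, 0 ≤ G (n + 1)) : ¬ Antitone fun j => G (b + j + 1) := by
  intro hanti
  set D := ∑ k, (Q.servers k : ℝ) * |Q.rate k * G (b + 1) - Q.opCost k|
  have hlarge : Tendsto (fun j => b + j + 1) atTop atTop :=
    tendsto_add_atTop_nat 1 |>.comp <| tendsto_atTop_mono (fun j => Nat.le_add_left j b) tendsto_id
  obtain ⟨j, hhold, hnonneg⟩ := (hlarge.eventually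
    ((hhold.eventually_gt_atTop (η + D)).and hnonneg)).exists
  have hbound : Q.maxGain (b + j + 1) (G (b + j + 1)) ≤ D :=
    (maxGain_mono _ (hanti j.zero_le)).trans (maxGain_le _ _)
  linarith [hG (b + j + 1) (by omega), mul_nonneg Q.arrival_pos.le hnonneg]

lemma lt_of_marginal_le (hG : Q.OptimalityEquation η b G) (hhold : Q.HoldingCostAssumption)
    (hnonneg : ∀ᶠ n in atTop, 0 ≤ G (n + 1))
    (hmarginal : Q.maxGain (b + 1) (G (b + 1)) - Q.maxGain b (G (b + 1))
      ≤ Q.hold (b + 1) - Q.hold b) : G (b + 1) < G (b + 2) :=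
  lt_of_not_ge fun hle =>
    hG.not_antitone hhold.tendsto hnonneg (hG.antitone hhold.convex hle hmarginal)

end OptimalityEquation

namespace IsOptimalWith

lemma optimalityEquation (h : Q.IsOptimalWith d w η) {b : ℕ} (hb : ∀ n, b < n → 0 < w n) :
    Q.OptimalityEquation η b (Q.valueDiff d η) := fun n hn => by
  rw [arrival_mul_valueDiff, (h.isMaximizer_of_pos (hb n hn)).maxGain_eq]

/- If all states up to some `b > 0` were transient or idle, then the value differences would not
increase from `b` to `b + 1`. -/
theorem pos (hhold : Q.HoldingCostAssumption) (h : Q.IsOptimalWith d w η) (n : ℕ) : 0 < w n := by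
  obtain ⟨b, hlt, hpos⟩ := h.stationary.exists_first_pos
  suffices b = 0 from hpos n (this ▸ n.zero_le)
  by_contra! hb0
  obtain ⟨b, rfl⟩ := Nat.exists_eq_succ_of_ne_zero hb0
  have h₀ := h.idle_below hlt (hpos _ le_rfl)
  set d₀ : ℕ → Fin K → ℕ := fun n => if n ≤ b + 1 then 0 else d n
  set G := Q.valueDiff d₀ η
  have hidle : ∀ j ≤ b + 1, Q.gain (d₀ j) (G j) = 0 := fun j hj => by
    rw [show d₀ j = 0 from if_pos hj, gain_zero]
  have hmaxGain : Q.maxGain (b + 1) (G (b + 1)) = 0 :=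
    (h₀.isMaximizer_of_pos (hpos _ le_rfl)).maxGain_eq.trans (hidle _ le_rfl)
  have hincreasing := hhold.increasing b.le_succ
  have hlt : G (b + 1) < G (b + 2) := (h₀.optimalityEquation hpos).lt_of_marginal_le hhold
    (h₀.stationary.eventually_valueDiff_nonneg hhold.tendsto h₀.hasSum)
    (by linarith [maxGain_nonneg (Q := Q) b (G (b + 1))])
  have hb₁ : Q.arrival * G (b + 1) = _ := arrival_mul_valueDiff b
  have hb₂ : Q.arrival * G (b + 2) = _ := arrival_mul_valueDiff (b + 1)
  rw [hidle _ b.le_succ] at hb₁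
  rw [hidle _ le_rfl] at hb₂
  linarith [mul_lt_mul_of_pos_left hlt Q.arrival_pos]

lemma isMaximizer (hhold : Q.HoldingCostAssumption) (h : Q.IsOptimalWith d w η) (n : ℕ) :
    Q.IsMaximizer n (Q.valueDiff d η n) (d n) :=
  h.isMaximizer_of_pos (h.pos hhold n)

theorem valueDiff_lt_succ (hhold : Q.HoldingCostAssumption) (h : Q.IsOptimalWith d w η) (n : ℕ) :
    Q.valueDiff d η (n + 1) < Q.valueDiff d η (n + 2) := by
  set G := Q.valueDiff d η
  have hG : ∀ n, Q.arrival * G (n + 1) = η - Q.hold n + Q.maxGain n (G n) := fun n => by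
    rw [arrival_mul_valueDiff, (h.isMaximizer hhold n).maxGain_eq]
  have hstep : ∀ n, Q.maxGain n (G n) ≤ Q.maxGain n (G (n + 1)) → G (n + 1) < G (n + 2) :=
    fun n hmono => lt_of_not_ge fun hle => hle.not_gt <|
      (h.optimalityEquation fun j _ => h.pos hhold j).lt_of_marginal_le hhold
        (h.stationary.eventually_valueDiff_nonneg hhold.tendsto h.hasSum)
        (by linarith [hG n, hG (n + 1), mul_le_mul_of_nonneg_left hle Q.arrival_pos.le])
  induction n with
  | zero => exact hstep 0 (by rw [maxGain_zero, maxGain_zero])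
  | succ n ih => exact hstep (n + 1) (maxGain_mono _ ih.le)

lemma valueDiff_strictMono (hhold : Q.HoldingCostAssumption) (h : Q.IsOptimalWith d w η) :
    StrictMono fun n => Q.valueDiff d η (n + 1) :=
  strictMono_nat_of_lt_succ (h.valueDiff_lt_succ hhold)

end IsOptimalWith

end GroupServerQueue

/-! ### Exchange of servers -/

namespace GroupServerQueue

variable {K : ℕ} {Q : GroupServerQueue K} {d : ℕ → Fin K → ℕ} {w : ℕ → ℝ} {η : ℝ} {n : ℕ}
  {x y : ℝ} {a a' m : Fin K → ℕ} {k l : Fin K}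

variable (Q) in
/-- The action `m` resolves ties between groups with equal ratio `c / μ` by their numbering:
`BreaksRatioTies` for a single action. -/
def ActionBreaksTies (m : Fin K → ℕ) : Prop :=
  ∀ k l, k < l → Q.opCost k / Q.rate k = Q.opCost l / Q.rate l → 0 < m l → m k = Q.servers k

lemma rate_mul_sub_opCost (k : Fin K) (x : ℝ) :
    Q.rate k * x - Q.opCost k = Q.rate k * (x - Q.opCost k / Q.rate k) := by
  rw [mul_sub, mul_div_cancel₀ _ (Q.rate_pos k).ne']

lemma serviceRate_add_single (m : Fin K → ℕ) (k : Fin K) :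
    Q.serviceRate (m + Pi.single k 1) = Q.serviceRate m + Q.rate k :=
  sum_add_single_mul m k Q.rate

/- With `k` both cheaper and faster, `μ_k (x - c_k / μ_k) ≤ μ_l (x - c_l / μ_l)` forces equality of
the ratios. -/
lemma ScaleEconomies.ratio_eq (hscale : Q.ScaleEconomies) (hkl : k ≤ l)
    (hx : Q.opCost k / Q.rate k ≤ x)
    (h : Q.rate k * x - Q.opCost k ≤ Q.rate l * x - Q.opCost l) :
    Q.opCost k / Q.rate k = Q.opCost l / Q.rate l := by
  rw [rate_mul_sub_opCost, rate_mul_sub_opCost] at h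
  have hfaster := mul_le_mul_of_nonneg_right (hscale.rate_descending k l hkl) (sub_nonneg.2 hx)
  have hmargin := le_of_mul_le_mul_left (hfaster.trans h) (Q.rate_pos l)
  exact le_antisymm (hscale.ratio_ascending k l hkl) (by linarith)

lemma exists_eq_succ_of_add_single_mem (hm : m + Pi.single k 1 ∈ Q.feasibleActions n) :
    ∃ n', n = n' + 1 := by
  have hcard := (mem_feasibleActions.1 hm).2
  rw [sum_add_single] at hcard
  exact ⟨n - 1, by omega⟩

lemma swap_mem_feasibleActions (hkl : k ≠ l) (hm : m + Pi.single l 1 ∈ Q.feasibleActions n)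
    (hk : (m + Pi.single l 1 : Fin K → ℕ) k < Q.servers k) :
    m + Pi.single k 1 ∈ Q.feasibleActions n := by
  obtain ⟨n, rfl⟩ := exists_eq_succ_of_add_single_mem hm
  exact add_single_mem_feasibleActions (mem_feasibleActions_of_add_single hm)
    (by simpa [hkl] using hk)

namespace IsMaximizer

lemma ratio_le_of_add_single (h : Q.IsMaximizer n x (m + Pi.single k 1)) :
    Q.opCost k / Q.rate k ≤ x := by
  obtain ⟨n, rfl⟩ := exists_eq_succ_of_add_single_mem h.1
  obtain ⟨hservers, hcard⟩ := mem_feasibleActions.1 (mem_feasibleActions_of_add_single h.1)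
  have hremove := h.2 m (mem_feasibleActions.2 ⟨hservers, Nat.le_succ_of_le hcard⟩)
  rw [gain_add_single, rate_mul_sub_opCost, le_add_iff_nonneg_right] at hremove
  exact sub_nonneg.1 (nonneg_of_mul_nonneg_right hremove (Q.rate_pos k))

lemma le_ratio_of_lt (h : Q.IsMaximizer (n + 1) x m) (hcard : ∑ j, m j ≤ n)
    (hk : m k < Q.servers k) : x ≤ Q.opCost k / Q.rate k := by
  have hadd := h.2 _ (add_single_mem_feasibleActions
    (mem_feasibleActions.2 ⟨(mem_feasibleActions.1 h.1).1, hcard⟩) hk)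
  rw [gain_add_single, rate_mul_sub_opCost, add_le_iff_nonpos_right] at hadd
  exact sub_nonpos.1 (nonpos_of_mul_nonpos_right hadd (Q.rate_pos k))

lemma rate_mul_sub_opCost_le (h : Q.IsMaximizer n x (m + Pi.single l 1)) (hkl : k ≠ l)
    (hk : (m + Pi.single l 1 : Fin K → ℕ) k < Q.servers k) :
    Q.rate k * x - Q.opCost k ≤ Q.rate l * x - Q.opCost l := by
  have hswap := h.2 _ (swap_mem_feasibleActions hkl h.1 hk)
  rwa [gain_add_single, gain_add_single, add_le_add_iff_left] at hswap

theorem le_of_lt (hscale : Q.ScaleEconomies) (hxy : x < y) (ha : Q.IsMaximizer n x a)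
    (hta : Q.ActionBreaksTies a) (ha' : Q.IsMaximizer (n + 1) y a')
    (hta' : Q.ActionBreaksTies a') : a ≤ a' := by
  intro k
  by_contra! hk
  obtain ⟨hservers, hcard⟩ := mem_feasibleActions.1 ha.1
  obtain ⟨hservers', -⟩ := mem_feasibleActions.1 ha'.1
  obtain ⟨b, hb⟩ := exists_eq_add_single (Nat.zero_lt_of_lt hk)
  have hxk : Q.opCost k / Q.rate k ≤ x := (hb ▸ ha).ratio_le_of_add_single
  have hk' : a' k < Q.servers k := hk.trans_le (hservers k)
  have hcard' : n < ∑ j, a' j := lt_of_not_ge fun hle =>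
    (hxk.trans_lt hxy).not_ge (ha'.le_ratio_of_lt hle hk')
  obtain ⟨l, -, hl⟩ := Finset.exists_lt_of_sum_lt (hcard.trans_lt hcard')
  obtain ⟨b', hb'⟩ := exists_eq_add_single (Nat.zero_lt_of_lt hl)
  have hl' : a l < Q.servers l := hl.trans_le (hservers' l)
  have hkl : k ≠ l := fun h => (h ▸ hk).not_gt hl
  rcases hkl.lt_or_gt with hlt | hlt
  · have hratio := hscale.ratio_eq hlt.le (hxk.trans hxy.le)
      ((hb' ▸ ha').rate_mul_sub_opCost_le hkl (hb' ▸ hk'))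
    exact hk'.ne (hta' k l hlt hratio (Nat.zero_lt_of_lt hl))
  · have hratio := hscale.ratio_eq hlt.le ((hscale.ratio_ascending l k hlt.le).trans hxk)
      ((hb ▸ ha).rate_mul_sub_opCost_le hkl.symm (hb ▸ hl'))
    exact hl'.ne (hta l k hlt hratio (Nat.zero_lt_of_lt hk))

lemma swap (hscale : Q.ScaleEconomies) (h : Q.IsMaximizer n x (m + Pi.single l 1)) (hkl : k < l)
    (hratio : Q.opCost k / Q.rate k = Q.opCost l / Q.rate l)
    (hk : (m + Pi.single l 1 : Fin K → ℕ) k < Q.servers k) :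
    Q.IsMaximizer n x (m + Pi.single k 1) ∧
      (Q.opCost k / Q.rate k ≠ x → Q.rate k = Q.rate l) := by
  have hle := h.rate_mul_sub_opCost_le hkl.ne hk
  have hge : Q.rate l * x - Q.opCost l ≤ Q.rate k * x - Q.opCost k := by
    rw [rate_mul_sub_opCost, rate_mul_sub_opCost, hratio]
    exact mul_le_mul_of_nonneg_right (hscale.rate_descending k l hkl.le)
      (sub_nonneg.2 h.ratio_le_of_add_single)
  have heq := le_antisymm hle hge
  have hgain : Q.gain (m + Pi.single k 1) x = Q.gain (m + Pi.single l 1) x := by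
    rw [gain_add_single, gain_add_single, heq]
  refine ⟨⟨swap_mem_feasibleActions hkl.ne h.1 hk, fun m' hm' => hgain ▸ h.2 m' hm'⟩, fun hne => ?_⟩
  rw [rate_mul_sub_opCost, rate_mul_sub_opCost, ← hratio] at heq
  exact mul_right_cancel₀ (sub_ne_zero.2 hne.symm) heq

/- Among the maximizers of the same service rate, take one with the smallest `∑ j, j * m j`: moving
a server from group `l` to group `k < l` would decrease this sum. -/
lemma exists_breaksTies (hscale : Q.ScaleEconomies) (h : Q.IsMaximizer n x a) :
    ∃ m, Q.IsMaximizer n x m ∧ Q.ActionBreaksTies m ∧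
      ((∀ k, Q.opCost k / Q.rate k ≠ x) → Q.serviceRate m = Q.serviceRate a) := by
  classical
  obtain ⟨m, hm, hmin⟩ := Finset.exists_min_image
    ((Q.feasibleActions n).filter fun m => Q.IsMaximizer n x m ∧
      ((∀ k, Q.opCost k / Q.rate k ≠ x) → Q.serviceRate m = Q.serviceRate a))
    (fun m => ∑ j : Fin K, m j * (j : ℕ)) ⟨a, Finset.mem_filter.2 ⟨h.1, h, fun _ => rfl⟩⟩
  obtain ⟨-, hmax, hrate⟩ := Finset.mem_filter.1 hm
  refine ⟨m, hmax, fun k l hkl hratio hl => ?_, hrate⟩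
  by_contra hk
  obtain ⟨b, rfl⟩ := exists_eq_add_single hl
  obtain ⟨hswap, hswap_rate⟩ := hmax.swap hscale hkl hratio
    (lt_of_le_of_ne ((mem_feasibleActions.1 hmax.1).1 k) hk)
  have hle := hmin (b + Pi.single k 1) <| Finset.mem_filter.2 ⟨hswap.1, hswap, fun hne => by
    rw [← hrate hne, serviceRate_add_single, serviceRate_add_single, hswap_rate (hne k)]⟩
  have hweight := fun i : Fin K => sum_add_single_mul b i fun j => (j : ℕ)
  simp only [Nat.cast_id] at hweight
  rw [hweight, hweight, add_le_add_iff_left] at hle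
  exact hle.not_gt hkl

end IsMaximizer

theorem IsOptimal.monotone (hhold : Q.HoldingCostAssumption) (hscale : Q.ScaleEconomies)
    (h : Q.IsOptimal d) (hties : Q.BreaksRatioTies d) : Monotone d := by
  obtain ⟨w, η, hw⟩ := h.exists_isOptimalWith hhold.tendsto
  refine monotone_nat_of_le_succ fun n => ?_
  cases n with
  | zero =>
    rw [serviceRate_eq_zero_iff.1 hw.efficient.serviceRate_zero]
    exact zero_le
  | succ n =>
    exact (hw.isMaximizer hhold (n + 1)).le_of_lt hscale (hw.valueDiff_lt_succ hhold n)
      (hties (n + 1)) (hw.isMaximizer hhold (n + 2)) (hties (n + 2))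

namespace IsOptimalWith

lemma exists_forall_lt_ratio_ne_valueDiff (hhold : Q.HoldingCostAssumption)
    (h : Q.IsOptimalWith d w η) :
    ∃ N, ∀ n, N < n → ∀ k, Q.opCost k / Q.rate k ≠ Q.valueDiff d η n := by
  have hfinite : {n | Q.valueDiff d η (n + 1) ∈ Set.range fun k => Q.opCost k / Q.rate k}.Finite :=
    (Set.finite_range _).preimage (h.valueDiff_strictMono hhold).injective.injOn
  obtain ⟨N, hN⟩ := hfinite.bddAbove
  refine ⟨N + 1, fun n hn k hk => ?_⟩
  obtain ⟨n, rfl⟩ := Nat.exists_eq_succ_of_ne_zero (Nat.ne_zero_of_lt hn)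
  exact (Nat.lt_of_succ_lt_succ hn).not_ge (hN ⟨k, hk⟩)

/- Policies that take maximizers in all states have the same performance, by the performance
difference formula; it applies because the rates differ in finitely many states only. -/
lemma exists_of_isMaximizer {d' : ℕ → Fin K → ℕ} (hhold : Q.HoldingCostAssumption)
    (h : Q.IsOptimalWith d w η) (hmax : ∀ n, Q.IsMaximizer n (Q.valueDiff d η n) (d' n)) {N : ℕ}
    (hrate : ∀ n, N < n → Q.serviceRate (d' n) = Q.serviceRate (d n)) :
    ∃ v, Q.IsOptimalWith d' v η := by
  have hgain : ∀ n, Q.gain (d' n) (Q.valueDiff d η n) = Q.gain (d n) (Q.valueDiff d η n) :=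
    fun n => (hmax n).maxGain_eq.symm.trans (h.isMaximizer hhold n).maxGain_eq
  have hcost : ∀ n, N < n → Q.costRate n (d' n) = Q.costRate n (d n) := fun n hn => by
    have hn' := hgain n
    rw [gain_eq n, gain_eq n, hrate n hn] at hn'
    linarith
  obtain ⟨v, η', hv, hη', -, hdiff⟩ :=
    h.stationary.exists_performance_difference h.hasSum (h.pos hhold N) hrate hcost
  rw [Finset.sum_eq_zero fun j _ => by rw [hgain, sub_self, mul_zero], sub_eq_zero] at hdiff
  exact ⟨v, fun n => mem_feasibleActions.1 (hmax n).1, hv, hdiff ▸ hη', h.le⟩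

end IsOptimalWith

theorem IsOptimal.exists_breaksRatioTies (hhold : Q.HoldingCostAssumption)
    (hscale : Q.ScaleEconomies) (h : Q.IsOptimal d) :
    ∃ d', Q.IsOptimal d' ∧ Q.BreaksRatioTies d' := by
  obtain ⟨w, η, hw⟩ := h.exists_isOptimalWith hhold.tendsto
  choose d' hmax hties hrate using fun n => (hw.isMaximizer hhold n).exists_breaksTies hscale
  obtain ⟨N, hN⟩ := hw.exists_forall_lt_ratio_ne_valueDiff hhold
  obtain ⟨v, hv⟩ := hw.exists_of_isMaximizer hhold hmax fun n hn => hrate n (hN n hn)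
  exact ⟨d', hv.isOptimal hhold.tendsto, hties⟩

end GroupServerQueue

theorem theorem8 {K : ℕ} (Q : GroupServerQueue K) (hhold : Q.HoldingCostAssumption)
    (hscale : Q.ScaleEconomies) :
    (∀ d : ℕ → Fin K → ℕ, Q.IsOptimal d → Q.BreaksRatioTies d →
      (∀ k : Fin K, Monotone fun n => d n k) ∧ Monotone d) ∧
    ((∃ d : ℕ → Fin K → ℕ, Q.IsOptimal d) →
      ∃ d : ℕ → Fin K → ℕ, Q.IsOptimal d ∧ Q.BreaksRatioTies d) := by
  refine ⟨fun d hd hties => ?_, fun ⟨d, hd⟩ => hd.exists_breaksRatioTies hhold hscale⟩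
  have hmono := hd.monotone hhold hscale hties
  exact ⟨fun k i j hij => hmono hij k, hmono⟩
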